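/- Let $n\ge 0$ and let $(W,S)$ be the Coxeter group of type $A_n$: $W=\mathcal S_{n+1}$, $S=\{s_1,\dots,s_n\}$ with $s_i=(i\ \,i{+}1)$, and $\ell(w)$ the number of inversions of $w$. *Definitions.* For $I\subset S$ let $W_I$ be the subgroup generated by $I$, $w_I$ its longest element, $\ell(I)=\ell(w_I)$. For $I,J\subset S$, an $(I,J)$-coset is a double coset $p\in W_I\backslash W/W_J$, with maximal element $\overline p$ and minimal element $\underline p$. Its left and right redundancies are $I\cap \underline pJ\underline p^{-1}$ and $\underline p^{-1}I\underline p\cap J$; $p$ is *core* if these equal $I$ and $J$. In general the core of $p$ is the $(K,L)$-coset with minimal element $\underline p$, where $K,L$ are the left and right redundancies of $p$. An $(I,J)$-expression is a sequence $[I=I_0,\dots,I_d=J]$ of subsets of $S$ in which consecutive sets differ by one element; $[I+s-t\cdots]$ denotes the expression that starts at $I$ and successively adds $s$, removes $t$, and so on. With $K_k=I_{k-1}\cup I_k$, it is a reduced expression for $p$ if $\overline p=w_{K_1}w_{I_1}^{-1}w_{K_2}\cdots w_{I_{d-1}}^{-1}w_{K_d}$ and $\ell(\overline p)=\ell(K_1)-\ell(I_1)+\ell(K_2)-\cdots+\ell(K_d)$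 (for $d=0$: $\overline p=w_I$). A coset is *atomic* if it is core and has a reduced expression $[I+s-t]$ for some $s,t\in S$. An *atomic reduced expression* of $p$ is a reduced expression of $p$ that is a concatenation of (possibly zero) reduced expressions $[I,M,J]$ of atomic cosets. For $J\subset S$ and $1\le i\le \#(S\setminus J)$, let $s$ be the $i$-th element of $S\setminus J$ in increasing order of index, $M=J\cup\{s\}$, $t=w_Msw_M$; $\mathtt a_i^J$ is the atomic coset expressed by $[M\setminus t,M,J]$. In a composite $\mathtt a_{i_d}\cdots \mathtt a_{i_0}^{J}$ the other superscripts are the ones that make the composition well-defined. The *atomic braid relations* replace, inside an expression, a contiguous subexpression $\mathtt a_i\mathtt a_{i+1}\mathtt a_i^J$ by $\mathtt a_{i+1}\mathtt a_i\mathtt a_{i+1}^J$, or $\mathtt a_i\mathtt a_j^J$ by $\mathtt a_j\mathtt a_i^J$ with $|i-j|>1$, or conversely. The following double coset braid relations may be applied to a contiguous subexpression, in either direction. *Upup*: $[I+s+t]\leftrightharpoons[I+t+s]$ for distinct $s,t\notin I$. *Downdown*: $[M-s-t]\leftrightharpoons[M-t-s]$ for distinct $s,t\in M$. *Switchback*: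 for $s,t\in M$ with $t\neq w_Msw_M$, $[M\setminus s,M,M\setminus t]\leftrightharpoons[M\setminus s\supset K]\circ A\circ[L\subset M\setminus t]$, where both sides are reduced expressions of the same coset $p$, $K$ and $L$ are the redundancies of $p$, and $A$ is an atomic reduced expression of the core of $p$. **Theorem.** 1. Let $p$ be a core $(I,J)$-coset. Any two atomic reduced expressions of $p$ are related by a finite sequence of atomic braid relations, all of whose terms are atomic reduced expressions of $p$. 2. Let $J\subset S$ and $1\le i<i+1\le\#(S\setminus J)$. There are $I\subset S$, a core $(I,J)$-coset $p$ and $s_a,\dots,s_f\in S$ such that the following are reduced expressions of $p$, the first and the last being atomic, and each is obtained from the previous one by the indicated relation: $$\mathtt a_i\mathtt a_{i+1}\mathtt a_i^J=[I+s_a-s_b+s_c-s_d+s_b-s_e]\ \overset{\text{switchback}}{\leftrightharpoons}\ [I+s_a+s_c-s_d-s_e]\ \overset{\text{upup}}{\leftrightharpoons}\ [I+s_c+s_a-s_d-s_e]$$ $$\overset{\text{downdown}}{\leftrightharpoons}\ [I+s_c+s_a-s_e-s_d]\ \overset{\text{switchback}}{\leftrightharpoons}\ [I+s_c-s_f+s_a-s_e+s_f-s_d]=\mathtt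 a_{i+1}\mathtt a_i\mathtt a_{i+1}^J .$$ 3. Let $J\subset S$ and $1\le i,j\le\#(S\setminus J)$ with $|i-j|>1$. There are $I\subset S$, a core $(I,J)$-coset $p$ and $s_a,s_b,s_c,s_d\in S$ such that, in the same sense, $$\mathtt a_i\mathtt a_j^J=[I+s_a-s_b+s_c-s_d]\ \overset{\text{switchback}}{\leftrightharpoons}\ [I+s_a+s_c-s_b-s_d]\ \overset{\text{upup}}{\leftrightharpoons}\ [I+s_c+s_a-s_b-s_d]$$ $$\overset{\text{downdown}}{\leftrightharpoons}\ [I+s_c+s_a-s_d-s_b]\ \overset{\text{switchback}}{\leftrightharpoons}\ [I+s_c-s_d+s_a-s_b]=\mathtt a_j\mathtt a_i^J .$$ -/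

import Mathlib

/-! Double cosets in the symmetric group on `n + 1` letters, the Coxeter group of type `A_n`,
with simple reflections `s_i = (i i+1)` indexed by `Fin n`. Subsets of simple reflections are
finsets of indices. All subsets are finitary since the group is finite. -/

namespace AtomicCoset

open scoped Classical in
/-- The Coxeter length of a permutation: its number of inversions. -/
noncomputable def length {n : ℕ} (w : Equiv.Perm (Fin (n + 1))) : ℕ :=
  (Finset.univ.filter fun x : Fin (n + 1) × Fin (n + 1) => x.1 < x.2 ∧ w x.2 < w x.1).card

/-- The simple reflection `s_i`. -/
def simple {n : ℕ} (i : Fin n) : Equiv.Perm (Fin (n + 1)) :=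
  Equiv.swap i.castSucc i.succ

/-- The parabolic subgroup `W_I`. -/
def parabolic {n : ℕ} (I : Finset (Fin n)) : Subgroup (Equiv.Perm (Fin (n + 1))) :=
  Subgroup.closure (simple '' (I : Set (Fin n)))

theorem exists_longest {n : ℕ} (I : Finset (Fin n)) :
    ∃ w ∈ parabolic I, ∀ v ∈ parabolic I, length v ≤ length w :=
  Set.exists_max_image (parabolic I : Set (Equiv.Perm (Fin (n + 1)))) length
    (Set.toFinite _) ⟨1, (parabolic I).one_mem⟩

/-- The longest element `w_I` of `W_I`. -/
noncomputable def longest {n : ℕ} (I : Finset (Fin n)) : Equiv.Perm (Fin (n + 1)) :=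
  (exists_longest I).choose

/-- `p` is an `(I,J)`-coset, that is, an element of `W_I \ W / W_J`. -/
def IsCoset {n : ℕ} (I J : Finset (Fin n)) (p : Set (Equiv.Perm (Fin (n + 1)))) : Prop :=
  ∃ w, p = DoubleCoset.doubleCoset w (parabolic I) (parabolic J)

/-- `x` is the maximal element of `p`. -/
def IsMaxElt {n : ℕ} (p : Set (Equiv.Perm (Fin (n + 1)))) (x : Equiv.Perm (Fin (n + 1))) : Prop :=
  x ∈ p ∧ ∀ y ∈ p, length y ≤ length x

/-- `x` is the minimal element of `p`. -/
def IsMinElt {n : ℕ} (p : Set (Equiv.Perm (Fin (n + 1)))) (x : Equiv.Perm (Fin (n + 1))) : Prop :=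
  x ∈ p ∧ ∀ y ∈ p, length x ≤ length y

open scoped Classical in
/-- The left redundancy `I ∩ x J x⁻¹` of the `(I,J)`-coset with minimal element `x`. -/
noncomputable def leftRed {n : ℕ} (I J : Finset (Fin n)) (x : Equiv.Perm (Fin (n + 1))) :
    Finset (Fin n) :=
  I.filter fun s => ∃ t ∈ J, simple s = x * simple t * x⁻¹

open scoped Classical in
/-- The right redundancy `x⁻¹ I x ∩ J` of the `(I,J)`-coset with minimal element `x`. -/
noncomputable def rightRed {n : ℕ} (I J : Finset (Fin n)) (x : Equiv.Perm (Fin (n + 1))) :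
    Finset (Fin n) :=
  J.filter fun t => ∃ s ∈ I, simple t = x⁻¹ * simple s * x

/-- `p` is a core `(I,J)`-coset. -/
def IsCore {n : ℕ} (I J : Finset (Fin n)) (p : Set (Equiv.Perm (Fin (n + 1)))) : Prop :=
  IsCoset I J p ∧ ∃ x, IsMinElt p x ∧ leftRed I J x = I ∧ rightRed I J x = J

/-- The `(K,L)`-coset `q` is the core of the `(I,J)`-coset `p`. -/
def IsCoreOf {n : ℕ} (I J : Finset (Fin n)) (p : Set (Equiv.Perm (Fin (n + 1))))
    (K L : Finset (Fin n)) (q : Set (Equiv.Perm (Fin (n + 1)))) : Prop :=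
  IsCoset I J p ∧ IsCoset K L q ∧
    ∃ x, IsMinElt p x ∧ IsMinElt q x ∧ K = leftRed I J x ∧ L = rightRed I J x

/-! ### Expressions -/

/-- `I` and `J` differ by adding or removing one simple reflection. -/
def Adjacent {n : ℕ} (I J : Finset (Fin n)) : Prop :=
  (∃ s, s ∉ I ∧ J = insert s I) ∨ (∃ s, s ∈ I ∧ J = I.erase s)

/-- `[I_0, ..., I_d]` is a (singlestep) `(I,J)`-expression. -/
def IsExpression {n : ℕ} (I J : Finset (Fin n)) (E : List (Finset (Fin n))) : Prop :=
  E.head? = some I ∧ E.getLast? = some J ∧ E.IsChain Adjacent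

/-- For `[I_0, ..., I_d]`, viewed as the multistep expression
`[[I_0 ⊂ K_1 ⊃ I_1 ⊂ ... ⊂ K_d ⊃ I_d]]` with `K_k = I_{k-1} ∪ I_k`, this is the product
`w_{K_1} w_{I_1}⁻¹ w_{K_2} ⋯ w_{I_{d-1}}⁻¹ w_{K_d}` (multiplied by `w_{I_d}⁻¹ w_{I_d} = 1`);
for `[I]` it is `w_I`. -/
noncomputable def exprProd {n : ℕ} : List (Finset (Fin n)) → Equiv.Perm (Fin (n + 1))
  | [] => 1
  | [I] => longest I
  | I :: J :: E => longest (I ∪ J) * (longest J)⁻¹ * exprProd (J :: E)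

/-- The alternating sum `ℓ(K_1) - ℓ(I_1) + ℓ(K_2) - ⋯ + ℓ(K_d)` for `[I_0, ..., I_d]`, with `K_k`
as in `exprProd` and `ℓ(I) = ℓ(w_I)`; for `[I]` it is `ℓ(I)`. -/
noncomputable def exprLength {n : ℕ} : List (Finset (Fin n)) → ℤ
  | [] => 0
  | [I] => length (longest I)
  | I :: J :: E => length (longest (I ∪ J)) - length (longest J) + exprLength (J :: E)

/-- `E` is a reduced expression for the `(I,J)`-coset `p`. -/
def IsReducedExpr {n : ℕ} (I J : Finset (Fin n)) (p : Set (Equiv.Perm (Fin (n + 1))))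
    (E : List (Finset (Fin n))) : Prop :=
  IsCoset I J p ∧ IsExpression I J E ∧ IsMaxElt p (exprProd E) ∧
    (length (exprProd E) : ℤ) = exprLength E

/-- A step `+ s` or `- s` of a singlestep expression. -/
inductive Step (n : ℕ) : Type
  | add (s : Fin n)
  | sub (s : Fin n)

/-- The list of subsets written `[I + s - t + ⋯]`. -/
def walk {n : ℕ} (I : Finset (Fin n)) : List (Step n) → List (Finset (Fin n))
  | [] => [I]
  | Step.add s :: l => I :: walk (insert s I) l
  | Step.sub s :: l => I :: walk (I.erase s) l

/-! ### Atomic cosets and atomic expressions -/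

/-- `p` is an atomic `(I,J)`-coset: it is core and has a reduced expression `[I + s - t]`. -/
def IsAtomic {n : ℕ} (I J : Finset (Fin n)) (p : Set (Equiv.Perm (Fin (n + 1)))) : Prop :=
  IsCore I J p ∧ ∃ s t, IsReducedExpr I J p (walk I [Step.add s, Step.sub t])

/-- `E` is a composition of (possibly no) reduced expressions `[I, M, J]` of atomic cosets. -/
inductive IsAtomicExpr {n : ℕ} : List (Finset (Fin n)) → Prop
  | nil (I : Finset (Fin n)) : IsAtomicExpr [I]
  | cons (I M J : Finset (Fin n)) (E : List (Finset (Fin n)))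
      (q : Set (Equiv.Perm (Fin (n + 1)))) (hq : IsAtomic I J q)
      (hr : IsReducedExpr I J q [I, M, J]) (hE : IsAtomicExpr (J :: E)) :
      IsAtomicExpr (I :: M :: J :: E)

/-- `E` is an atomic reduced expression for the `(I,J)`-coset `p`. -/
def IsAtomicReducedExpr {n : ℕ} (I J : Finset (Fin n)) (p : Set (Equiv.Perm (Fin (n + 1))))
    (E : List (Finset (Fin n))) : Prop :=
  IsReducedExpr I J p E ∧ IsAtomicExpr E

/-- `[I, M, J]` is the expression `[Js \ t, Js, J]` of `a_i^J`: here `s` is the `i`-th element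
of `S \ J` in increasing order (counted from `1`) and `t = w_{Js} s w_{Js}`. -/
def IsAtom {n : ℕ} (i : ℕ) (I M J : Finset (Fin n)) : Prop :=
  ∃ s t, s ∉ J ∧ (Finset.univ.filter fun r => r ∉ J ∧ r ≤ s).card = i ∧ M = insert s J ∧
    t ∈ M ∧ simple t = longest M * simple s * longest M ∧ I = M.erase t

/-- `E` is the composite of the expressions of the atomic cosets `a_{i_d} * ⋯ * a_{i_0}^J`, where
`[i_d, ..., i_0]` is the given list of indices. -/
inductive IsAtomWord {n : ℕ} (J : Finset (Fin n)) : List ℕ → List (Finset (Fin n)) → Prop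
  | nil : IsAtomWord J [] [J]
  | cons (i : ℕ) (is : List ℕ) (I M K : Finset (Fin n)) (E : List (Finset (Fin n)))
      (h : IsAtom i I M K) (hE : IsAtomWord J is (K :: E)) :
      IsAtomWord J (i :: is) (I :: M :: K :: E)

/-- The atomic braid relations `a_i a_{i+1} a_i ↔ a_{i+1} a_i a_{i+1}` and `a_i a_j ↔ a_j a_i`
for `|i - j| > 1`. -/
inductive AtomicBraid {n : ℕ} : List (Finset (Fin n)) → List (Finset (Fin n)) → Prop
  | braid (J : Finset (Fin n)) (i : ℕ) (X Y : List (Finset (Fin n)))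
      (hX : IsAtomWord J [i, i + 1, i] X) (hY : IsAtomWord J [i + 1, i, i + 1] Y) :
      AtomicBraid X Y
  | comm (J : Finset (Fin n)) (i j : ℕ) (hij : i + 1 < j ∨ j + 1 < i)
      (X Y : List (Finset (Fin n)))
      (hX : IsAtomWord J [i, j] X) (hY : IsAtomWord J [j, i] Y) :
      AtomicBraid X Y

/-- `F` is obtained from `E` by replacing a contiguous subexpression `X` by `Y`, where `R X Y`. -/
def InContext {n : ℕ} (R : List (Finset (Fin n)) → List (Finset (Fin n)) → Prop)
    (E F : List (Finset (Fin n))) : Prop :=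
  ∃ A X Y B, R X Y ∧ E = A ++ X ++ B ∧ F = A ++ Y ++ B

/-- One application, in either direction, of an atomic braid relation between atomic reduced
expressions of `p`. -/
def AtomicMove {n : ℕ} (I J : Finset (Fin n)) (p : Set (Equiv.Perm (Fin (n + 1))))
    (E F : List (Finset (Fin n))) : Prop :=
  IsAtomicReducedExpr I J p E ∧ IsAtomicReducedExpr I J p F ∧
    (InContext AtomicBraid E F ∨ InContext AtomicBraid F E)

/-! ### Double coset braid relations -/

/-- The upup relation `[I + s + t] ⇌ [I + t + s]`. -/
def UpUp {n : ℕ} (X Y : List (Finset (Fin n))) : Prop :=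
  ∃ I s t, s ∉ I ∧ t ∉ I ∧ s ≠ t ∧
    X = walk I [Step.add s, Step.add t] ∧ Y = walk I [Step.add t, Step.add s]

/-- The downdown relation `[M - s - t] ⇌ [M - t - s]`. -/
def DownDown {n : ℕ} (X Y : List (Finset (Fin n))) : Prop :=
  ∃ M s t, s ∈ M ∧ t ∈ M ∧ s ≠ t ∧
    X = walk M [Step.sub s, Step.sub t] ∧ Y = walk M [Step.sub t, Step.sub s]

/-- The switchback relation: for `s, t ∈ M` with `t ≠ w_M s w_M`, it relates `[M \ s, M, M \ t]`,
expressing `p`, to the reduced expression `[[M \ s ⊃ K]] ∘ A ∘ [[L ⊂ M \ t]]` of `p`, where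
`A` is an atomic reduced expression of the core of `p`, which is a `(K,L)`-coset. -/
def Switchback {n : ℕ} (X Y : List (Finset (Fin n))) : Prop :=
  ∃ (M : Finset (Fin n)) (s t : Fin n) (p : Set (Equiv.Perm (Fin (n + 1))))
    (K L : Finset (Fin n)) (q : Set (Equiv.Perm (Fin (n + 1)))) (A : List (Finset (Fin n))),
    s ∈ M ∧ t ∈ M ∧ simple t ≠ longest M * simple s * longest M ∧
    X = [M.erase s, M, M.erase t] ∧ IsReducedExpr (M.erase s) (M.erase t) p X ∧
    IsCoreOf (M.erase s) (M.erase t) p K L q ∧ IsAtomicReducedExpr K L q A ∧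
    Y = [M.erase s] ++ A ++ [M.erase t] ∧ IsReducedExpr (M.erase s) (M.erase t) p Y

end AtomicCoset

open AtomicCoset AtomicCoset.Step

/-!
The orbits of `W_J` on the letters are intervals, the blocks of `J`. The atomic coset `a_i^J`
exchanges the blocks `i` and `i + 1` of `J` and keeps the order of the letters inside each block.
A composite of atoms is therefore a word in the adjacent transpositions of block numbers: the
product of the word is the permutation of the blocks induced by the coset, and the composite is
reduced exactly if the word is. Two atomic reduced expressions of a coset give reduced words of the
same permutation, so Matsumoto's theorem for the symmetric group connects these words by braid
relations, and each of them lifts to an atomic braid relation.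

The composites `a_i a_{i+1} a_i^J` and `a_i a_j^J` reverse all blocks of `J` that are contained in
the same block of `Q`, where `Q` arises from `J` by adding the two simple reflections between the
blocks involved. Hence they are expressions of the longest element of `W_Q`, just as
`[I + a + c - d - e]` with `Q = I + a + c` is; upup and downdown exchange the two ways of ascending
to `Q` and of descending from it. If the first and the last step of a composite are dropped, what
remains is a block permutation from `L` to `K`. It does not carry the two blocks of `L` joined in
`Q - d` to the two blocks of `K` joined in `Q - c`. Hence `K` and `L` are the redundancies of the
coset of `[Q - c, Q, Q - d]`, and the remaining step is a switchback.
-/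

namespace AtomicCoset

section Blocks

variable {n : ℕ} {I J : Finset (Fin n)}

/-! ### Blocks of a subset of simple reflections -/

/-- The orbits of `W_J` are intervals, the blocks of `J`; they are numbered from left to right
starting with `1`, and `blockIndex J p` is the number of the block containing `p`. -/
def blockIndex (J : Finset (Fin n)) (p : Fin (n + 1)) : ℕ :=
  1 + (Jᶜ.filter fun c => c.castSucc < p).card

theorem one_le_blockIndex (J : Finset (Fin n)) (p : Fin (n + 1)) : 1 ≤ blockIndex J p :=
  Nat.le_add_right 1 _

theorem blockIndex_mono (J : Finset (Fin n)) : Monotone (blockIndex J) := by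
  intro p q h
  unfold blockIndex
  gcongr

theorem lt_of_blockIndex_lt {p q : Fin (n + 1)} (h : blockIndex J p < blockIndex J q) : p < q :=
  (blockIndex_mono J).reflect_lt h

theorem lt_iff_blockIndex_lt {p q : Fin (n + 1)} (h : blockIndex J p ≠ blockIndex J q) :
    p < q ↔ blockIndex J p < blockIndex J q :=
  ⟨fun hpq => (blockIndex_mono J hpq.le).lt_of_ne h, lt_of_blockIndex_lt⟩

theorem blockIndex_zero (J : Finset (Fin n)) : blockIndex J 0 = 1 := by
  simp [blockIndex]

theorem blockIndex_last (J : Finset (Fin n)) : blockIndex J (Fin.last n) = Jᶜ.card + 1 := by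
  simp [blockIndex, Fin.castSucc_lt_last, add_comm]

theorem blockIndex_succ_of_mem {t : Fin n} (h : t ∈ J) :
    blockIndex J t.succ = blockIndex J t.castSucc := by
  unfold blockIndex
  congr 2
  ext c
  simp only [Finset.mem_filter, Finset.mem_compl, Fin.castSucc_lt_succ_iff,
    Fin.castSucc_lt_castSucc_iff]
  refine and_congr_right fun hc => ⟨fun hle => lt_of_le_of_ne hle ?_, le_of_lt⟩
  rintro rfl
  exact hc h

theorem blockIndex_succ_of_notMem {t : Fin n} (h : t ∉ J) :
    blockIndex J t.succ = blockIndex J t.castSucc + 1 := by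
  have hfilter : (Jᶜ.filter fun c => c.castSucc < t.succ)
      = insert t (Jᶜ.filter fun c => c.castSucc < t.castSucc) := by
    ext c
    simp only [Finset.mem_filter, Finset.mem_compl, Fin.castSucc_lt_succ_iff,
      Fin.castSucc_lt_castSucc_iff, Finset.mem_insert, le_iff_lt_or_eq]
    grind
  rw [blockIndex, hfilter, Finset.card_insert_of_notMem (by simp), blockIndex, add_assoc]

theorem blockIndex_succ_eq_iff {t : Fin n} :
    blockIndex J t.succ = blockIndex J t.castSucc ↔ t ∈ J := by
  refine ⟨fun h => ?_, blockIndex_succ_of_mem⟩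
  by_contra ht
  rw [blockIndex_succ_of_notMem ht] at h
  omega

theorem blockIndex_eq_blockIndex_insert_add {s : Fin n} (h : s ∉ J) (p : Fin (n + 1)) :
    blockIndex J p = blockIndex (insert s J) p + if s.castSucc < p then 1 else 0 := by
  have hcompl : Jᶜ = insert s (insert s J)ᶜ := by
    ext c
    by_cases hc : c = s <;> simp [hc, h]
  rw [blockIndex, hcompl, Finset.filter_insert, blockIndex]
  split_ifs
  · rw [Finset.card_insert_of_notMem (by simp), add_assoc]
  · rfl

theorem rel_of_blockIndex_eq {R : Fin (n + 1) → Fin (n + 1) → Prop}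
    (hR : ∀ a b c, R a b → R b c → R a c) (h : ∀ t ∈ J, R t.castSucc t.succ)
    {p q : Fin (n + 1)} (hb : blockIndex J p = blockIndex J q) (hpq : p < q) : R p q := by
  induction q using Fin.induction with
  | zero => exact absurd hpq (Fin.not_lt_zero _)
  | succ t ih =>
    have hpt : p ≤ t.castSucc := Fin.le_castSucc_iff.2 hpq
    have hle := blockIndex_mono J hpt
    have hle' := blockIndex_mono J (Fin.castSucc_lt_succ (i := t)).le
    have ht : t ∈ J := blockIndex_succ_eq_iff.1 (by omega)
    rcases hpt.eq_or_lt with rfl | hlt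
    · exact h t ht
    · exact hR _ _ _ (ih (by omega) hlt) (h t ht)

theorem blockIndex_eq_of_subset (h : I ⊆ J) {p q : Fin (n + 1)}
    (hb : blockIndex I p = blockIndex I q) : blockIndex J p = blockIndex J q := by
  have key {a b : Fin (n + 1)} (hb : blockIndex I a = blockIndex I b) (hab : a < b) :
      blockIndex J a = blockIndex J b :=
    rel_of_blockIndex_eq (R := fun a b => blockIndex J a = blockIndex J b)
      (fun _ _ _ => Eq.trans) (fun _ ht => (blockIndex_succ_of_mem (h ht)).symm) hb hab
  rcases lt_trichotomy p q with hpq | rfl | hpq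
  · exact key hb hpq
  · rfl
  · exact (key hb.symm hpq).symm

theorem exists_eq_simple_of_covBy {a b : Fin (n + 1)} (hab : a ⋖ b)
    (h : blockIndex I a = blockIndex I b) : ∃ s ∈ I, a = s.castSucc ∧ b = s.succ := by
  have hval : a.val + 1 = b.val := by simpa using Fin.covBy_iff.1 hab
  have ha : a = Fin.castSucc ⟨a.val, by omega⟩ := rfl
  have hb : b = Fin.succ ⟨a.val, by omega⟩ := Fin.ext hval.symm
  refine ⟨⟨a.val, by omega⟩, blockIndex_succ_eq_iff.1 ?_, ha, hb⟩
  rw [← ha, ← hb, h]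

/-- `r` is the `i`-th element of `S \ J`, counted from `1`: it separates the blocks `i` and
`i + 1` of `J`. -/
def IsCut (J : Finset (Fin n)) (i : ℕ) (r : Fin n) : Prop :=
  r ∉ J ∧ blockIndex J r.castSucc = i

theorem IsCut.blockIndex_succ {i : ℕ} {r : Fin n} (h : IsCut J i r) :
    blockIndex J r.succ = i + 1 := by
  rw [blockIndex_succ_of_notMem h.1, h.2]

theorem IsCut.castSucc_lt_iff {i : ℕ} {r : Fin n} (h : IsCut J i r) {p : Fin (n + 1)} :
    r.castSucc < p ↔ i < blockIndex J p := by
  refine ⟨fun hp => ?_, fun hp => lt_of_blockIndex_lt (h.2.trans_lt hp)⟩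
  have := blockIndex_mono J (Fin.castSucc_lt_iff_succ_le.1 hp)
  rw [h.blockIndex_succ] at this
  exact this

theorem IsCut.unique {i : ℕ} {r r' : Fin n} (h : IsCut J i r) (h' : IsCut J i r') : r = r' := by
  apply Fin.castSucc_injective
  refine le_antisymm ?_ ?_ <;> rw [← not_lt]
  · rw [h'.castSucc_lt_iff, h.2]
    exact lt_irrefl i
  · rw [h.castSucc_lt_iff, h'.2]
    exact lt_irrefl i

theorem exists_isCut {i : ℕ} (hi : 1 ≤ i) (hi' : i ≤ Jᶜ.card) : ∃ r, IsCut J i r := by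
  have key (p : Fin (n + 1)) : i < blockIndex J p → ∃ r, IsCut J i r := by
    induction p using Fin.induction with
    | zero =>
      rw [blockIndex_zero]
      omega
    | succ t ih =>
      intro h
      by_cases hlt : i < blockIndex J t.castSucc
      · exact ih hlt
      by_cases ht : t ∈ J
      · rw [blockIndex_succ_of_mem ht] at h
        exact absurd h hlt
      · rw [blockIndex_succ_of_notMem ht] at h
        exact ⟨t, ht, by omega⟩
  exact key (Fin.last n) (by rw [blockIndex_last]; omega)

theorem IsCut.one_le {i : ℕ} {r : Fin n} (h : IsCut J i r) : 1 ≤ i :=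
  h.2 ▸ one_le_blockIndex J _

theorem IsCut.le_card_compl {i : ℕ} {r : Fin n} (h : IsCut J i r) : i ≤ Jᶜ.card := by
  have := blockIndex_mono J (Fin.le_last r.succ)
  rw [h.blockIndex_succ, blockIndex_last] at this
  omega

theorem isCut_iff_card_filter {i : ℕ} {s : Fin n} :
    IsCut J i s ↔ s ∉ J ∧ (Finset.univ.filter fun r => r ∉ J ∧ r ≤ s).card = i := by
  refine and_congr_right fun hs => ?_
  have hfilter : (Finset.univ.filter fun r => r ∉ J ∧ r ≤ s)
      = insert s (Jᶜ.filter fun c => c.castSucc < s.castSucc) := by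
    ext c
    simp only [Finset.mem_filter, Finset.mem_univ, true_and, Finset.mem_insert, Finset.mem_compl,
      Fin.castSucc_lt_castSucc_iff, le_iff_lt_or_eq]
    grind
  rw [hfilter, Finset.card_insert_of_notMem (by simp), blockIndex, add_comm]

/-! ### Inversions -/

theorem perm_eq_of_lt_iff_lt {x y : Equiv.Perm (Fin (n + 1))}
    (h : ∀ p q, p < q → (x p < x q ↔ y p < y q)) : x = y := by
  have hlt {p q : Fin (n + 1)} (hx : x p < x q) : y p < y q := by
    rcases lt_trichotomy p q with hpq | rfl | hpq
    · exact (h p q hpq).1 hx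
    · exact absurd hx (lt_irrefl _)
    · refine (not_lt.1 fun hy => ?_).lt_of_ne (y.injective.ne hpq.ne')
      exact hx.asymm ((h q p hpq).2 hy)
  have hmono : StrictMono (y ∘ x.symm) := fun p q hpq => hlt (by simpa using hpq)
  have hid : y ∘ x.symm = id := (StrictMono.range_inj hmono strictMono_id).1 (by
    rw [Set.range_id, (y.surjective.comp x.symm.surjective).range_eq])
  ext p
  simpa using congrArg Fin.val (congrFun hid (x p)).symm

open scoped Classical in
/-- The number of inversions of `v` that become non-inversions in `u * v`; twice this number is
the defect of additivity of the length. -/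
noncomputable def cancelledInversions (u v : Equiv.Perm (Fin (n + 1))) : ℕ :=
  (Finset.univ.filter fun x : Fin (n + 1) × Fin (n + 1) =>
    x.1 < x.2 ∧ v x.2 < v x.1 ∧ u (v x.1) < u (v x.2)).card

theorem length_eq_sum_add_cancelledInversions (u v : Equiv.Perm (Fin (n + 1))) :
    length u = ∑ x : Fin (n + 1) × Fin (n + 1),
      (if x.1 < x.2 ∧ v x.1 < v x.2 ∧ u (v x.2) < u (v x.1) then 1 else 0)
        + cancelledInversions u v := by
  classical
  have hcancel : cancelledInversions u v = ∑ x : Fin (n + 1) × Fin (n + 1),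
      (if x.2 < x.1 ∧ v x.1 < v x.2 ∧ u (v x.2) < u (v x.1) then 1 else 0) := by
    rw [cancelledInversions, Finset.card_filter, ← Equiv.sum_comp (Equiv.prodComm _ _)]
    rfl
  rw [hcancel, length, Finset.card_filter, ← Equiv.sum_comp (Equiv.prodCongr v v),
    ← Finset.sum_add_distrib]
  refine Finset.sum_congr rfl fun ⟨p, q⟩ _ => ?_
  simp only [Equiv.prodCongr_apply, Prod.map_apply]
  rcases lt_trichotomy p q with h | rfl | h
  · simp [h, h.not_gt]
  · simp
  · simp [h, h.not_gt]

theorem length_add_length (u v : Equiv.Perm (Fin (n + 1))) :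
    length u + length v = length (u * v) + 2 * cancelledInversions u v := by
  classical
  rw [length_eq_sum_add_cancelledInversions u v]
  simp only [length, cancelledInversions, Finset.card_filter, Finset.mul_sum,
    ← Finset.sum_add_distrib]
  refine Finset.sum_congr rfl fun ⟨p, q⟩ _ => ?_
  simp only [Equiv.Perm.mul_apply]
  by_cases h : p < q
  · have hv : v p < v q ∨ v q < v p := lt_or_gt_of_ne (v.injective.ne h.ne)
    have hu : u (v p) < u (v q) ∨ u (v q) < u (v p) :=
      lt_or_gt_of_ne (u.injective.ne (v.injective.ne h.ne))
    rcases hv with hv | hv <;> rcases hu with hu | hu <;>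
      simp [h, hv, hu, hv.not_gt, hu.not_gt]
  · simp [h]

theorem cancelledInversions_eq_zero_iff {u v : Equiv.Perm (Fin (n + 1))} :
    cancelledInversions u v = 0 ↔ ∀ p q, p < q → v q < v p → u (v q) < u (v p) := by
  classical
  rw [cancelledInversions, Finset.card_eq_zero, Finset.filter_eq_empty_iff]
  constructor
  · intro h p q hpq hv
    have hle : u (v q) ≤ u (v p) := not_lt.1 fun hu => h (Finset.mem_univ (p, q)) ⟨hpq, hv, hu⟩
    exact hle.lt_of_ne (u.injective.ne hv.ne)
  · rintro h ⟨p, q⟩ - ⟨hpq, hv, hu⟩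
    exact (h p q hpq hv).asymm hu

theorem length_mul_eq_add {u v : Equiv.Perm (Fin (n + 1))}
    (h : ∀ p q, p < q → v q < v p → u (v q) < u (v p)) :
    length (u * v) = length u + length v := by
  have := length_add_length u v
  rw [cancelledInversions_eq_zero_iff.2 h] at this
  omega

/-! ### Simple reflections -/

theorem simple_castSucc (t : Fin n) : simple t t.castSucc = t.succ := Equiv.swap_apply_left _ _

theorem simple_succ (t : Fin n) : simple t t.succ = t.castSucc := Equiv.swap_apply_right _ _

theorem length_simple_pos (t : Fin n) : 0 < length (simple t) := by
  classical
  refine Finset.card_pos.2 ⟨(t.castSucc, t.succ), ?_⟩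
  simp [simple_castSucc, simple_succ]

theorem length_lt_length_mul_simple {w : Equiv.Perm (Fin (n + 1))} {t : Fin n}
    (h : w t.castSucc < w t.succ) : length w < length (w * simple t) := by
  have hadd : length (w * simple t) = length w + length (simple t) := by
    refine length_mul_eq_add fun p q hpq hs => ?_
    have hpt : p = t.castSucc ∧ q = t.succ := by
      rw [simple, Equiv.swap_apply_def, Equiv.swap_apply_def] at hs
      simp only [Fin.lt_def, Fin.ext_iff] at *
      split_ifs at hs <;> simp_all <;> omega
    rwa [hpt.1, hpt.2, simple_castSucc, simple_succ]
  have := length_simple_pos t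
  omega

theorem conj_simple (w : Equiv.Perm (Fin (n + 1))) (t : Fin n) :
    w * simple t * w⁻¹ = Equiv.swap (w t.castSucc) (w t.succ) := by
  rw [simple, Equiv.swap_apply_apply]

theorem simple_eq_swap_iff {a b : Fin (n + 1)} {s : Fin n} : simple s = Equiv.swap a b ↔
    (a = s.castSucc ∧ b = s.succ) ∨ (a = s.succ ∧ b = s.castSucc) := by
  constructor
  · intro h
    have hs : Equiv.swap a b s.castSucc = s.succ := by rw [← h, simple_castSucc]
    rw [Equiv.swap_apply_def] at hs
    split_ifs at hs with ha hb
    · exact Or.inl ⟨ha.symm, hs⟩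
    · exact Or.inr ⟨hs, hb.symm⟩
    · exact absurd hs Fin.castSucc_lt_succ.ne
  · rintro (⟨rfl, rfl⟩ | ⟨rfl, rfl⟩)
    · rfl
    · exact Equiv.swap_comm _ _

theorem simple_injective : Function.Injective (simple (n := n)) := by
  intro s t h
  rcases simple_eq_swap_iff.1 h with ⟨hc, -⟩ | ⟨hc, hs⟩
  · exact (Fin.castSucc_injective n hc).symm
  · simp only [Fin.ext_iff, Fin.val_castSucc, Fin.val_succ] at hc hs
    omega

end Blocks

section BlockPermutations

variable {n : ℕ} {I I' J K M : Finset (Fin n)} {w x y z : Equiv.Perm (Fin (n + 1))}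

/-! ### Parabolic subgroups and their longest elements -/

theorem simple_mem_parabolic {t : Fin n} (h : t ∈ J) : simple t ∈ parabolic J :=
  Subgroup.subset_closure ⟨t, h, rfl⟩

theorem parabolic_mono (h : I ⊆ J) : parabolic I ≤ parabolic J :=
  Subgroup.closure_mono (Set.image_mono (Finset.coe_subset.2 h))

theorem blockIndex_simple_apply {t : Fin n} (h : t ∈ J) (p : Fin (n + 1)) :
    blockIndex J (simple t p) = blockIndex J p := by
  rw [simple, Equiv.swap_apply_def]
  split_ifs with hc hs
  · rw [hc, blockIndex_succ_of_mem h]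
  · rw [hs, blockIndex_succ_of_mem h]
  · rfl

theorem blockIndex_apply (h : w ∈ parabolic J) (p : Fin (n + 1)) :
    blockIndex J (w p) = blockIndex J p := by
  induction h using Subgroup.closure_induction generalizing p with
  | mem x hx =>
    obtain ⟨t, ht, rfl⟩ := hx
    exact blockIndex_simple_apply ht p
  | one => rfl
  | mul x y _ _ hx hy => rw [Equiv.Perm.mul_apply, hx, hy]
  | inv x _ hx => rw [← hx, Equiv.Perm.coe_inv, Equiv.apply_symm_apply]

theorem simple_mem_parabolic_iff {t : Fin n} : simple t ∈ parabolic J ↔ t ∈ J := by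
  refine ⟨fun h => ?_, simple_mem_parabolic⟩
  have := blockIndex_apply h t.castSucc
  rwa [simple_castSucc, blockIndex_succ_eq_iff] at this

/-- `x` is increasing on each block of `J`; equivalently, `x` is of minimal length in `x W_J`. -/
def IncreasingOnBlocks (J : Finset (Fin n)) (x : Equiv.Perm (Fin (n + 1))) : Prop :=
  ∀ t ∈ J, x t.castSucc < x t.succ

/-- `x` is decreasing on each block of `J`; equivalently, `x` is of maximal length in `x W_J`. -/
def DecreasingOnBlocks (J : Finset (Fin n)) (x : Equiv.Perm (Fin (n + 1))) : Prop :=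
  ∀ t ∈ J, x t.succ < x t.castSucc

theorem IncreasingOnBlocks.lt (h : IncreasingOnBlocks J x) {p q : Fin (n + 1)}
    (hb : blockIndex J p = blockIndex J q) (hpq : p < q) : x p < x q :=
  rel_of_blockIndex_eq (R := fun p q => x p < x q) (fun _ _ _ => lt_trans) h hb hpq

theorem DecreasingOnBlocks.lt (h : DecreasingOnBlocks J x) {p q : Fin (n + 1)}
    (hb : blockIndex J p = blockIndex J q) (hpq : p < q) : x q < x p :=
  rel_of_blockIndex_eq (R := fun p q => x q < x p) (fun _ _ _ => gt_trans) h hb hpq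

theorem IncreasingOnBlocks.length_mul (h : IncreasingOnBlocks J x) (hw : w ∈ parabolic J) :
    length (x * w) = length x + length w := by
  refine length_mul_eq_add fun p q hpq hlt => h.lt ?_ hlt
  refine le_antisymm (blockIndex_mono J hlt.le) ?_
  rw [blockIndex_apply hw, blockIndex_apply hw]
  exact blockIndex_mono J hpq.le

theorem eq_one_of_increasingOnBlocks (hb : ∀ p, blockIndex J (w p) = blockIndex J p)
    (h : IncreasingOnBlocks J w) : w = 1 := by
  refine perm_eq_of_lt_iff_lt fun p q hpq => iff_of_true ?_ hpq
  rcases (blockIndex_mono J hpq.le).eq_or_lt with heq | hlt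
  · exact h.lt heq hpq
  · exact lt_of_blockIndex_lt (J := J) (by rwa [hb, hb])

theorem longest_mem_parabolic (J : Finset (Fin n)) : longest J ∈ parabolic J :=
  (exists_longest J).choose_spec.1

theorem length_le_length_longest (h : w ∈ parabolic J) : length w ≤ length (longest J) :=
  (exists_longest J).choose_spec.2 w h

theorem blockIndex_longest_apply (J : Finset (Fin n)) (p : Fin (n + 1)) :
    blockIndex J (longest J p) = blockIndex J p :=
  blockIndex_apply (longest_mem_parabolic J) p

theorem decreasingOnBlocks_longest (J : Finset (Fin n)) : DecreasingOnBlocks J (longest J) := by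
  intro t ht
  refine (not_lt.1 fun hlt => ?_).lt_of_ne ((longest J).injective.ne Fin.castSucc_lt_succ.ne')
  have hmem := mul_mem (longest_mem_parabolic J) (simple_mem_parabolic ht)
  exact (length_le_length_longest hmem).not_gt (length_lt_length_mul_simple hlt)

theorem eq_longest_of_decreasingOnBlocks (hb : ∀ p, blockIndex J (w p) = blockIndex J p)
    (h : DecreasingOnBlocks J w) : w = longest J := by
  refine perm_eq_of_lt_iff_lt fun p q hpq => ?_
  rcases (blockIndex_mono J hpq.le).eq_or_lt with heq | hlt
  · exact iff_of_false (h.lt heq hpq).not_gt ((decreasingOnBlocks_longest J).lt heq hpq).not_gt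
  · refine iff_of_true (lt_of_blockIndex_lt (J := J) ?_) (lt_of_blockIndex_lt (J := J) ?_)
    · rwa [hb, hb]
    · rwa [blockIndex_longest_apply, blockIndex_longest_apply]

theorem longest_mul_self (J : Finset (Fin n)) : longest J * longest J = 1 := by
  refine eq_one_of_increasingOnBlocks (J := J) (fun p => ?_) fun t ht => ?_
  · rw [Equiv.Perm.mul_apply, blockIndex_longest_apply, blockIndex_longest_apply]
  · refine (decreasingOnBlocks_longest J).lt ?_ (decreasingOnBlocks_longest J t ht)
    rw [blockIndex_longest_apply, blockIndex_longest_apply, blockIndex_succ_of_mem ht]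

theorem longest_inv (J : Finset (Fin n)) : (longest J)⁻¹ = longest J :=
  inv_eq_of_mul_eq_one_left (longest_mul_self J)

theorem longest_longest_apply (J : Finset (Fin n)) (p : Fin (n + 1)) :
    longest J (longest J p) = p := by
  rw [← Equiv.Perm.mul_apply, longest_mul_self, Equiv.Perm.one_apply]

theorem longest_apply_lt_iff {p q : Fin (n + 1)} (h : blockIndex J p = blockIndex J q) :
    longest J p < longest J q ↔ q < p := by
  rcases lt_trichotomy p q with hpq | rfl | hqp
  · exact iff_of_false ((decreasingOnBlocks_longest J).lt h hpq).not_gt hpq.not_gt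
  · simp
  · exact iff_of_true ((decreasingOnBlocks_longest J).lt h.symm hqp) hqp

theorem exists_longest_apply {s : Fin n} (hs : s ∈ M) :
    ∃ t ∈ M, longest M s.succ = t.castSucc ∧ longest M s.castSucc = t.succ := by
  have hb := blockIndex_longest_apply M
  have heq : blockIndex M (longest M s.succ) = blockIndex M (longest M s.castSucc) := by
    rw [hb, hb, blockIndex_succ_of_mem hs]
  refine exists_eq_simple_of_covBy ⟨decreasingOnBlocks_longest M s hs, fun c hlt hgt => ?_⟩ heq
  have hc : blockIndex M c = blockIndex M s.castSucc := by
    have h₁ := blockIndex_mono M hlt.le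
    have h₂ := blockIndex_mono M hgt.le
    rw [heq, hb] at h₁
    rw [hb] at h₂
    omega
  have hsc : s.castSucc < longest M c := by
    rw [← longest_apply_lt_iff (by rw [hb, hc]), longest_longest_apply]
    exact hgt
  have hcs : longest M c < s.succ := by
    rw [← longest_apply_lt_iff (by rw [hb, hc, blockIndex_succ_of_mem hs]), longest_longest_apply]
    exact hlt
  exact (Fin.castSucc_lt_iff_succ_le.1 hsc).not_gt hcs

/-! ### Block permutations -/

/-- The `(I, J)`-coset of `x`. -/
abbrev coset (I J : Finset (Fin n)) (x : Equiv.Perm (Fin (n + 1))) :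
    Set (Equiv.Perm (Fin (n + 1))) :=
  DoubleCoset.doubleCoset x (parabolic I) (parabolic J)

/-- `x` maps the blocks of `J` onto the blocks of `I`, increasingly on each block of `J`, and
permutes their numbers by `π`. Such `x` are the minimal elements of the core `(I, J)`-cosets. -/
structure PermutesBlocks (I J : Finset (Fin n)) (π : Equiv.Perm ℕ)
    (x : Equiv.Perm (Fin (n + 1))) : Prop where
  blockIndex_apply : ∀ p, blockIndex I (x p) = π (blockIndex J p)
  increasing : IncreasingOnBlocks J x

section PermutesBlocks

variable {π σ : Equiv.Perm ℕ}

theorem PermutesBlocks.one (J : Finset (Fin n)) : PermutesBlocks J J 1 1 :=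
  ⟨fun _ => rfl, fun _ _ => Fin.castSucc_lt_succ⟩

theorem PermutesBlocks.blockIndex_eq_iff (h : PermutesBlocks I J π x) {p q : Fin (n + 1)} :
    blockIndex I (x p) = blockIndex I (x q) ↔ blockIndex J p = blockIndex J q := by
  rw [h.blockIndex_apply, h.blockIndex_apply, π.injective.eq_iff]

theorem PermutesBlocks.mul (hy : PermutesBlocks I K σ y) (hx : PermutesBlocks K J π x) :
    PermutesBlocks I J (σ * π) (y * x) := by
  refine ⟨fun p => ?_, fun t ht => hy.increasing.lt ?_ (hx.increasing t ht)⟩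
  · rw [Equiv.Perm.mul_apply, hy.blockIndex_apply, hx.blockIndex_apply, Equiv.Perm.mul_apply]
  · rw [hx.blockIndex_eq_iff, blockIndex_succ_of_mem ht]

theorem PermutesBlocks.inv (h : PermutesBlocks I J π x) : PermutesBlocks J I π⁻¹ x⁻¹ := by
  have hb (p : Fin (n + 1)) : blockIndex J (x⁻¹ p) = π⁻¹ (blockIndex I p) := by
    rw [Equiv.Perm.eq_inv_iff_eq, ← h.blockIndex_apply, Equiv.Perm.coe_inv,
      Equiv.apply_symm_apply]
  refine ⟨hb, fun s hs => ?_⟩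
  refine (not_lt.1 fun hlt => ?_).lt_of_ne (x⁻¹.injective.ne Fin.castSucc_lt_succ.ne)
  have := h.increasing.lt (by rw [hb, hb, blockIndex_succ_of_mem hs]) hlt
  simp only [Equiv.Perm.coe_inv, Equiv.apply_symm_apply] at this
  exact this.asymm Fin.castSucc_lt_succ

theorem PermutesBlocks.apply_lt_apply_iff (h : PermutesBlocks I J π x) {p q : Fin (n + 1)}
    (hb : blockIndex J p ≠ blockIndex J q) :
    x p < x q ↔ π (blockIndex J p) < π (blockIndex J q) := by
  rw [← h.blockIndex_apply, ← h.blockIndex_apply]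
  exact lt_iff_blockIndex_lt (h.blockIndex_eq_iff.not.2 hb)

theorem PermutesBlocks.perm_eq (hx : PermutesBlocks I J π x) (hy : PermutesBlocks I' J π y) :
    x = y := by
  refine perm_eq_of_lt_iff_lt fun p q hpq => ?_
  by_cases hb : blockIndex J p = blockIndex J q
  · exact iff_of_true (hx.increasing.lt hb hpq) (hy.increasing.lt hb hpq)
  · rw [hx.apply_lt_apply_iff hb, hy.apply_lt_apply_iff hb]

theorem PermutesBlocks.exists_apply (h : PermutesBlocks I J π x) {t : Fin n} (ht : t ∈ J) :
    ∃ s ∈ I, x t.castSucc = s.castSucc ∧ x t.succ = s.succ := by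
  have heq : blockIndex I (x t.castSucc) = blockIndex I (x t.succ) := by
    rw [h.blockIndex_eq_iff, blockIndex_succ_of_mem ht]
  refine exists_eq_simple_of_covBy ⟨h.increasing t ht, fun c hlt hgt => ?_⟩ heq
  have hc : blockIndex I (x t.castSucc) = blockIndex I c :=
    (blockIndex_mono I hlt.le).antisymm (heq ▸ blockIndex_mono I hgt.le)
  have hlt' := h.inv.increasing.lt hc hlt
  have hgt' := h.inv.increasing.lt (hc.symm.trans heq) hgt
  simp only [Equiv.Perm.coe_inv, Equiv.symm_apply_apply] at hlt' hgt'
  exact (Fin.castSucc_lt_iff_succ_le.1 hlt').not_gt hgt'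

theorem PermutesBlocks.exists_simple_eq_conj (h : PermutesBlocks I J π x) {t : Fin n}
    (ht : t ∈ J) : ∃ s ∈ I, simple s = x * simple t * x⁻¹ := by
  obtain ⟨s, hs, hc, hsucc⟩ := h.exists_apply ht
  exact ⟨s, hs, by rw [conj_simple, hc, hsucc, simple]⟩

theorem PermutesBlocks.exists_simple_eq_conj_inv (h : PermutesBlocks I J π x) {s : Fin n}
    (hs : s ∈ I) : ∃ t ∈ J, simple t = x⁻¹ * simple s * x := by
  obtain ⟨t, ht, heq⟩ := h.inv.exists_simple_eq_conj hs
  exact ⟨t, ht, by rw [heq, inv_inv]⟩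

theorem PermutesBlocks.subset (h : PermutesBlocks I J π x) (h' : PermutesBlocks I' J σ x) :
    I ⊆ I' := by
  intro s hs
  obtain ⟨t, ht, hts⟩ := h.exists_simple_eq_conj_inv hs
  obtain ⟨s', hs', hst⟩ := h'.exists_simple_eq_conj ht
  have : simple s' = simple s := by rw [hst, hts]; group
  rwa [← simple_injective this]

theorem PermutesBlocks.left_eq (h : PermutesBlocks I J π x) (h' : PermutesBlocks I' J π y) :
    I = I' := by
  obtain rfl := h.perm_eq h'
  exact (h.subset h').antisymm (h'.subset h)

end PermutesBlocks

/-! ### Cosets of block permutations -/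

theorem conj_mem_parabolic (h : ∀ s ∈ I, x⁻¹ * simple s * x ∈ parabolic J)
    (hw : w ∈ parabolic I) : x⁻¹ * w * x ∈ parabolic J := by
  have hle : parabolic I ≤ (parabolic J).comap (MulAut.conj x⁻¹).toMonoidHom := by
    rw [parabolic, Subgroup.closure_le]
    rintro _ ⟨s, hs, rfl⟩
    simpa using h s hs
  simpa using hle hw

theorem mem_coset_iff (h : ∀ s ∈ I, x⁻¹ * simple s * x ∈ parabolic J) :
    z ∈ coset I J x ↔ x⁻¹ * z ∈ parabolic J := by
  rw [DoubleCoset.mem_doubleCoset]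
  constructor
  · rintro ⟨a, ha, b, hb, rfl⟩
    convert mul_mem (conj_mem_parabolic h ha) hb using 1
    group
  · exact fun hz => ⟨1, one_mem _, _, hz, by group⟩

theorem PermutesBlocks.mem_coset_iff {π : Equiv.Perm ℕ} (h : PermutesBlocks I J π x) :
    z ∈ coset I J x ↔ x⁻¹ * z ∈ parabolic J := by
  refine AtomicCoset.mem_coset_iff fun s hs => ?_
  obtain ⟨t, ht, heq⟩ := h.exists_simple_eq_conj_inv hs
  exact heq ▸ simple_mem_parabolic ht

theorem PermutesBlocks.eq_of_mem_coset {π : Equiv.Perm ℕ} (h : PermutesBlocks I J π x)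
    (hz : z ∈ coset I J x) (hinc : IncreasingOnBlocks J z) : z = x := by
  have hmem := h.mem_coset_iff.1 hz
  have hb := AtomicCoset.blockIndex_apply hmem
  refine (inv_mul_eq_one.1 (eq_one_of_increasingOnBlocks hb fun t ht => ?_)).symm
  refine h.inv.increasing.lt ?_ (hinc t ht)
  rw [← h.inv.blockIndex_eq_iff]
  exact (hb _).trans ((blockIndex_succ_of_mem ht).symm.trans (hb _).symm)

theorem PermutesBlocks.isMaxElt {π : Equiv.Perm ℕ} (h : PermutesBlocks I J π x) :
    IsMaxElt (coset I J x) (x * longest J) := by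
  refine ⟨?_, fun y hy => ?_⟩
  · rw [h.mem_coset_iff, inv_mul_cancel_left]
    exact longest_mem_parabolic J
  · rw [h.mem_coset_iff] at hy
    have hlen := h.increasing.length_mul hy
    have hle := length_le_length_longest hy
    rw [mul_inv_cancel_left] at hlen
    rw [h.increasing.length_mul (longest_mem_parabolic J)]
    omega

open scoped Classical in
/-- The number of inversions of `w` that are between different blocks of `J` and take values in
different blocks of `I`. It is constant on `(I, J)`-cosets, and equals the length of `w` if `w` is
of minimal length in `W_I w` and in `w W_J`. -/
noncomputable def blockInversions (I J : Finset (Fin n)) (w : Equiv.Perm (Fin (n + 1))) : ℕ :=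
  (Finset.univ.filter fun x : Fin (n + 1) × Fin (n + 1) =>
    blockIndex J x.1 < blockIndex J x.2 ∧ blockIndex I (w x.2) < blockIndex I (w x.1)).card

theorem blockInversions_le_length (I J : Finset (Fin n)) (w : Equiv.Perm (Fin (n + 1))) :
    blockInversions I J w ≤ length w := by
  classical
  refine Finset.card_le_card fun x => ?_
  simp only [Finset.mem_filter, Finset.mem_univ, true_and]
  exact And.imp lt_of_blockIndex_lt lt_of_blockIndex_lt

theorem blockInversions_mul_mul {a b : Equiv.Perm (Fin (n + 1))}
    (ha : a ∈ parabolic I) (hb : b ∈ parabolic J) :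
    blockInversions I J (a * w * b) = blockInversions I J w := by
  classical
  rw [blockInversions, blockInversions, Finset.card_filter, Finset.card_filter,
    ← Equiv.sum_comp (Equiv.prodCongr b b) (fun x => if blockIndex J x.1 < blockIndex J x.2 ∧
      blockIndex I (w x.2) < blockIndex I (w x.1) then 1 else 0)]
  refine Finset.sum_congr rfl fun ⟨p, q⟩ _ => ?_
  simp only [Equiv.Perm.mul_apply, blockIndex_apply ha, Equiv.prodCongr_apply, Prod.map_apply,
    blockIndex_apply hb]

theorem blockInversions_eq_length (hJ : IncreasingOnBlocks J x) (hI : IncreasingOnBlocks I x⁻¹) :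
    blockInversions I J x = length x := by
  classical
  refine (blockInversions_le_length I J x).antisymm (Finset.card_le_card fun ⟨p, q⟩ => ?_)
  simp only [Finset.mem_filter, Finset.mem_univ, true_and]
  rintro ⟨hpq, hlt⟩
  refine ⟨(blockIndex_mono J hpq.le).lt_of_ne fun hb => (hJ.lt hb hpq).asymm hlt,
    (blockIndex_mono I hlt.le).lt_of_ne fun hb => ?_⟩
  have := hI.lt hb hlt
  simp only [Equiv.Perm.coe_inv, Equiv.symm_apply_apply] at this
  exact this.asymm hpq

theorem isMinElt_of_increasingOnBlocks (hJ : IncreasingOnBlocks J x)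
    (hI : IncreasingOnBlocks I x⁻¹) : IsMinElt (coset I J x) x := by
  refine ⟨DoubleCoset.mem_doubleCoset_self _ _ _, fun y hy => ?_⟩
  obtain ⟨a, ha, b, hb, rfl⟩ := DoubleCoset.mem_doubleCoset.1 hy
  rw [← blockInversions_eq_length hJ hI, ← blockInversions_mul_mul ha hb]
  exact blockInversions_le_length _ _ _

theorem PermutesBlocks.isMinElt {π : Equiv.Perm ℕ} (h : PermutesBlocks I J π x) :
    IsMinElt (coset I J x) x :=
  isMinElt_of_increasingOnBlocks h.increasing h.inv.increasing

theorem PermutesBlocks.leftRed_eq {π : Equiv.Perm ℕ} (h : PermutesBlocks I J π x) :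
    leftRed I J x = I := by
  classical
  refine Finset.filter_true_of_mem fun s hs => ?_
  obtain ⟨t, ht, heq⟩ := h.exists_simple_eq_conj_inv hs
  exact ⟨t, ht, by rw [heq]; group⟩

theorem rightRed_eq_leftRed_inv (I J : Finset (Fin n)) (x : Equiv.Perm (Fin (n + 1))) :
    rightRed I J x = leftRed J I x⁻¹ := by
  rw [rightRed, leftRed, inv_inv]

theorem PermutesBlocks.rightRed_eq {π : Equiv.Perm ℕ} (h : PermutesBlocks I J π x) :
    rightRed I J x = J := by
  rw [rightRed_eq_leftRed_inv, h.inv.leftRed_eq]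

theorem PermutesBlocks.isCore {π : Equiv.Perm ℕ} (h : PermutesBlocks I J π x) :
    IsCore I J (coset I J x) :=
  ⟨⟨x, rfl⟩, x, h.isMinElt, h.leftRed_eq, h.rightRed_eq⟩

end BlockPermutations

section Atoms

variable {n : ℕ} {I K M : Finset (Fin n)}

/-! ### Expressions -/

theorem exprProd_cons_of_subset (h : I ⊆ M) (E : List (Finset (Fin n))) :
    exprProd (I :: M :: E) = exprProd (M :: E) := by
  rw [exprProd, Finset.union_eq_right.2 h, mul_inv_cancel, one_mul]

theorem exprProd_cons_of_superset (h : K ⊆ M) (E : List (Finset (Fin n))) :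
    exprProd (M :: K :: E) = longest M * longest K * exprProd (K :: E) := by
  rw [exprProd, Finset.union_eq_left.2 h, longest_inv]

theorem exprLength_cons_of_subset (h : I ⊆ M) (E : List (Finset (Fin n))) :
    exprLength (I :: M :: E) = exprLength (M :: E) := by
  rw [exprLength, Finset.union_eq_right.2 h, sub_self, zero_add]

theorem exprLength_cons_of_superset (h : K ⊆ M) (E : List (Finset (Fin n))) :
    exprLength (M :: K :: E) = length (longest M) - length (longest K) + exprLength (K :: E) := by
  rw [exprLength, Finset.union_eq_left.2 h]

theorem Adjacent.insert {s : Fin n} (h : s ∉ I) : Adjacent I (insert s I) :=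
  Or.inl ⟨s, h, rfl⟩

theorem Adjacent.erase {s : Fin n} (h : s ∈ I) : Adjacent I (I.erase s) :=
  Or.inr ⟨s, h, rfl⟩

/-! ### Atoms -/

/-- `[I, M, K]` is the expression of the atomic coset `a_i^K`, with `M = K + s` and `I = M - t`,
where `t = w_M s w_M`. -/
structure IsAtomVia (i : ℕ) (I M K : Finset (Fin n)) (s t : Fin n) : Prop where
  isCut : IsCut K i s
  eq_insert : M = insert s K
  longest_apply_succ : longest M s.succ = t.castSucc
  longest_apply_castSucc : longest M s.castSucc = t.succ
  eq_erase : I = M.erase t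

theorem exists_isAtomVia {i : ℕ} {s : Fin n} (h : IsCut K i s) :
    ∃ t, IsAtomVia i ((insert s K).erase t) (insert s K) K s t := by
  obtain ⟨t, -, hsucc, hcast⟩ := exists_longest_apply (Finset.mem_insert_self s K)
  exact ⟨t, h, rfl, hsucc, hcast, rfl⟩

namespace IsAtomVia

variable {i j : ℕ} {s t r : Fin n}

theorem mem_right (h : IsAtomVia i I M K s t) : s ∈ M :=
  h.eq_insert ▸ Finset.mem_insert_self s K

theorem mem_left (h : IsAtomVia i I M K s t) : t ∈ M := by
  rw [← blockIndex_succ_eq_iff, ← h.longest_apply_succ, ← h.longest_apply_castSucc,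
    blockIndex_longest_apply, blockIndex_longest_apply, blockIndex_succ_of_mem h.mem_right]

theorem notMem_left (h : IsAtomVia i I M K s t) : t ∉ I :=
  h.eq_erase ▸ Finset.notMem_erase t M

theorem right_subset (h : IsAtomVia i I M K s t) : K ⊆ M :=
  h.eq_insert ▸ Finset.subset_insert s K

theorem left_subset (h : IsAtomVia i I M K s t) : I ⊆ M :=
  h.eq_erase ▸ Finset.erase_subset t M

theorem insert_left (h : IsAtomVia i I M K s t) : insert t I = M := by
  rw [h.eq_erase, Finset.insert_erase h.mem_left]

theorem erase_right (h : IsAtomVia i I M K s t) : M.erase s = K := by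
  rw [h.eq_insert, Finset.erase_insert h.isCut.1]

theorem adjacent_left (h : IsAtomVia i I M K s t) : Adjacent I M :=
  h.insert_left ▸ Adjacent.insert h.notMem_left

theorem adjacent_right (h : IsAtomVia i I M K s t) : Adjacent M K :=
  h.erase_right ▸ Adjacent.erase h.mem_right

theorem card_compl_eq (h : IsAtomVia i I M K s t) : Iᶜ.card = Kᶜ.card := by
  rw [Finset.card_compl, Finset.card_compl, h.eq_erase, ← h.erase_right,
    Finset.card_erase_of_mem h.mem_left, Finset.card_erase_of_mem h.mem_right]

theorem simple_eq_conj (h : IsAtomVia i I M K s t) :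
    simple t = longest M * simple s * longest M := by
  have hconj : longest M * simple s * longest M = longest M * simple s * (longest M)⁻¹ := by
    rw [longest_inv]
  rw [hconj, conj_simple, h.longest_apply_succ, h.longest_apply_castSucc, Equiv.swap_comm, simple]

theorem of_simple_eq_conj (hs : IsCut K i s)
    (h : simple t = longest (insert s K) * simple s * longest (insert s K)) :
    IsAtomVia i ((insert s K).erase t) (insert s K) K s t := by
  obtain ⟨t', h'⟩ := exists_isAtomVia hs
  obtain rfl : t = t' := simple_injective (h.trans h'.simple_eq_conj.symm)
  exact h'

theorem blockIndex_right (h : IsAtomVia i I M K s t) (p : Fin (n + 1)) :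
    blockIndex K p = blockIndex M p + if s.castSucc < p then 1 else 0 := by
  rw [h.eq_insert]
  exact blockIndex_eq_blockIndex_insert_add h.isCut.1 p

theorem blockIndex_left (h : IsAtomVia i I M K s t) (p : Fin (n + 1)) :
    blockIndex I p = blockIndex M p + if t.castSucc < p then 1 else 0 := by
  rw [← h.insert_left]
  exact blockIndex_eq_blockIndex_insert_add h.notMem_left p

theorem blockIndex_mid_right (h : IsAtomVia i I M K s t) : blockIndex M s.castSucc = i := by
  have := h.blockIndex_right s.castSucc
  rw [h.isCut.2, if_neg (lt_irrefl _)] at this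
  exact this.symm

theorem blockIndex_mid_left (h : IsAtomVia i I M K s t) : blockIndex M t.castSucc = i := by
  rw [← h.longest_apply_succ, blockIndex_longest_apply, blockIndex_succ_of_mem h.mem_right,
    h.blockIndex_mid_right]

theorem isCut_left (h : IsAtomVia i I M K s t) : IsCut I i t :=
  ⟨h.notMem_left, by rw [h.blockIndex_left, h.blockIndex_mid_left, if_neg (lt_irrefl _), add_zero]⟩

theorem isCut_of_ne (h : IsAtomVia i I M K s t) (hr : IsCut K j r) (hj : j ≠ i) :
    IsCut I j r := by
  have hrs : r ≠ s := fun heq => hj (hr.2.symm.trans (heq ▸ h.isCut.2))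
  have hrM : IsCut M (blockIndex M r.castSucc) r := by
    refine ⟨?_, rfl⟩
    rw [h.eq_insert, Finset.mem_insert, not_or]
    exact ⟨hrs, hr.1⟩
  have hrt : r ≠ t := fun heq => hrM.1 (heq ▸ h.mem_left)
  have hside : s.castSucc < r.castSucc ↔ t.castSucc < r.castSucc := by
    rw [← not_iff_not, not_lt, not_lt, le_iff_lt_or_eq, le_iff_lt_or_eq, hrM.castSucc_lt_iff,
      hrM.castSucc_lt_iff, h.blockIndex_mid_right, h.blockIndex_mid_left,
      Fin.castSucc_injective n |>.eq_iff, Fin.castSucc_injective n |>.eq_iff]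
    simp only [hrs, hrt]
  refine ⟨fun hrI => hrM.1 (h.left_subset hrI), ?_⟩
  rw [← hr.2, h.blockIndex_left, h.blockIndex_right]
  simp only [hside]

theorem castSucc_lt_longest_apply_iff (h : IsAtomVia i I M K s t) {p : Fin (n + 1)}
    (hp : blockIndex M p = i) :
    t.castSucc < longest M (longest K p) ↔ ¬ s.castSucc < p := by
  have hKp : blockIndex M (longest K p) = i := by
    rw [blockIndex_eq_of_subset h.right_subset (blockIndex_longest_apply K p), hp]
  rw [← h.longest_apply_succ, longest_apply_lt_iff, ← Fin.le_castSucc_iff, ← not_lt,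
    h.isCut.castSucc_lt_iff, blockIndex_longest_apply, ← h.isCut.castSucc_lt_iff]
  rw [hKp, blockIndex_succ_of_mem h.mem_right, h.blockIndex_mid_right]

theorem permutesBlocks (h : IsAtomVia i I M K s t) :
    PermutesBlocks I K (Equiv.swap i (i + 1)) (longest M * longest K) := by
  have hmid (p : Fin (n + 1)) : blockIndex M (longest K p) = blockIndex M p :=
    blockIndex_eq_of_subset h.right_subset (blockIndex_longest_apply K p)
  refine ⟨fun p => ?_, fun r hr => ?_⟩
  · rw [Equiv.Perm.mul_apply, h.blockIndex_left, blockIndex_longest_apply, hmid,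
      h.blockIndex_right]
    by_cases hp : blockIndex M p = i
    · simp only [h.castSucc_lt_longest_apply_iff hp, hp]
      by_cases hsp : s.castSucc < p <;> simp [hsp]
    · have ht : t.castSucc < longest M (longest K p) ↔ i < blockIndex M p := by
        rw [lt_iff_blockIndex_lt (J := M), h.blockIndex_mid_left, blockIndex_longest_apply, hmid]
        rw [h.blockIndex_mid_left, blockIndex_longest_apply, hmid]
        exact Ne.symm hp
      have hs : s.castSucc < p ↔ i < blockIndex M p := by
        rw [lt_iff_blockIndex_lt (J := M), h.blockIndex_mid_right]
        rw [h.blockIndex_mid_right]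
        exact Ne.symm hp
      simp only [ht, hs]
      split_ifs
      all_goals rw [Equiv.swap_apply_of_ne_of_ne] <;> omega
  · rw [Equiv.Perm.mul_apply, Equiv.Perm.mul_apply, longest_apply_lt_iff]
    · exact decreasingOnBlocks_longest K r hr
    · rw [hmid, hmid, blockIndex_eq_of_subset h.right_subset (blockIndex_succ_of_mem hr)]

theorem exprProd_cons (h : IsAtomVia i I M K s t) (E : List (Finset (Fin n))) :
    exprProd (I :: M :: K :: E) = longest M * longest K * exprProd (K :: E) := by
  rw [exprProd_cons_of_subset h.left_subset, exprProd_cons_of_superset h.right_subset]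

theorem exprLength_cons (h : IsAtomVia i I M K s t) (E : List (Finset (Fin n))) :
    exprLength (I :: M :: K :: E) =
      length (longest M * longest K) + exprLength (K :: E) := by
  have := h.permutesBlocks.increasing.length_mul (longest_mem_parabolic K)
  rw [mul_assoc, longest_mul_self, mul_one] at this
  rw [exprLength_cons_of_subset h.left_subset, exprLength_cons_of_superset h.right_subset, this]
  push_cast
  ring

theorem walk_cons (h : IsAtomVia i I M K s t) (l : List (Step n)) :
    walk I (add t :: sub s :: l) = I :: M :: walk K l := by
  rw [walk, walk, h.insert_left, h.erase_right]

theorem isReducedExpr (h : IsAtomVia i I M K s t) :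
    IsReducedExpr I K (coset I K (longest M * longest K)) [I, M, K] := by
  refine ⟨⟨_, rfl⟩, ⟨rfl, rfl, ?_⟩, ?_, ?_⟩
  · simp [h.adjacent_left, h.adjacent_right]
  · rw [h.exprProd_cons, exprProd]
    exact h.permutesBlocks.isMaxElt
  · rw [h.exprProd_cons, h.exprLength_cons, exprProd, exprLength,
      h.permutesBlocks.increasing.length_mul (longest_mem_parabolic K)]
    push_cast
    rfl

theorem isAtomic (h : IsAtomVia i I M K s t) :
    IsAtomic I K (coset I K (longest M * longest K)) :=
  ⟨h.permutesBlocks.isCore, t, s, by rw [h.walk_cons]; exact h.isReducedExpr⟩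

end IsAtomVia

theorem isAtom_iff {i : ℕ} : IsAtom i I M K ↔ ∃ s t, IsAtomVia i I M K s t := by
  constructor
  · rintro ⟨s, t, hs, hcard, rfl, -, h, rfl⟩
    exact ⟨s, t, .of_simple_eq_conj (isCut_iff_card_filter.2 ⟨hs, hcard⟩) h⟩
  · rintro ⟨s, t, h⟩
    obtain ⟨hs, hcard⟩ := isCut_iff_card_filter.1 h.isCut
    exact ⟨s, t, hs, hcard, h.eq_insert, h.mem_left, h.simple_eq_conj, h.eq_erase⟩

end Atoms

section Core

variable {n : ℕ} {I J M : Finset (Fin n)} {q : Set (Equiv.Perm (Fin (n + 1)))}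
  {a b x y z : Equiv.Perm (Fin (n + 1))}

/-! ### Atomic cosets are the cosets of atoms -/

theorem IsCoset.mul_mul_mem (hq : IsCoset I J q) (ha : a ∈ parabolic I) (hb : b ∈ parabolic J)
    (hz : z ∈ q) : a * z * b ∈ q := by
  obtain ⟨w, rfl⟩ := hq
  obtain ⟨a', ha', b', hb', rfl⟩ := DoubleCoset.mem_doubleCoset.1 hz
  exact DoubleCoset.mem_doubleCoset.2 ⟨a * a', mul_mem ha ha', b' * b, mul_mem hb' hb, by group⟩

theorem IsCore.exists_conj (hq : IsCore I J q) : ∃ x, q = coset I J x ∧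
    (∀ s ∈ I, ∃ t ∈ J, simple s = x * simple t * x⁻¹) ∧
    ∀ t ∈ J, ∃ s ∈ I, simple t = x⁻¹ * simple s * x := by
  classical
  obtain ⟨⟨w, rfl⟩, x, hx, hl, hr⟩ := hq
  exact ⟨x, (DoubleCoset.doubleCoset_eq_of_mem hx.1).symm,
    Finset.filter_eq_self.1 hl, Finset.filter_eq_self.1 hr⟩

theorem IsCore.card_eq (hq : IsCore I J q) : I.card = J.card := by
  obtain ⟨x, -, hI, hJ⟩ := hq.exists_conj
  choose! f hf using hI
  choose! g hg using hJ
  refine le_antisymm (Finset.card_le_card_of_injOn f (fun s hs => (hf s hs).1) ?_)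
    (Finset.card_le_card_of_injOn g (fun t ht => (hg t ht).1) ?_)
  · exact fun s hs s' hs' h => simple_injective (by rw [(hf s hs).2, (hf s' hs').2, h])
  · exact fun t ht t' ht' h => simple_injective (by rw [(hg t ht).2, (hg t' ht').2, h])

theorem IsCore.inv_mul_mem (hq : IsCore I J q) (hy : y ∈ q) (hz : z ∈ q) :
    y⁻¹ * z ∈ parabolic J := by
  obtain ⟨x, rfl, hI, -⟩ := hq.exists_conj
  have hconj : ∀ s ∈ I, x⁻¹ * simple s * x ∈ parabolic J := fun s hs => by
    obtain ⟨t, ht, heq⟩ := hI s hs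
    convert simple_mem_parabolic ht using 1
    rw [heq]
    group
  rw [mem_coset_iff hconj] at hy hz
  convert mul_mem (inv_mem hy) hz using 1
  group

theorem longest_notMem_parabolic_erase {t : Fin n} (ht : t ∈ M) :
    longest M ∉ parabolic (M.erase t) := by
  intro h
  have hle := blockIndex_mono (M.erase t) (decreasingOnBlocks_longest M t ht).le
  rw [blockIndex_apply h, blockIndex_apply h,
    blockIndex_succ_of_notMem (Finset.notMem_erase t M)] at hle
  omega

theorem exprProd_of_subset_of_superset (hI : I ⊆ M) (hJ : J ⊆ M) :
    exprProd [I, M, J] = longest M := by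
  rw [exprProd_cons_of_subset hI, exprProd_cons_of_superset hJ, exprProd, mul_assoc,
    longest_mul_self, mul_one]

theorem Adjacent.ne (h : Adjacent I J) : I ≠ J := by
  rintro rfl
  rcases h with ⟨s, hs, h⟩ | ⟨s, hs, h⟩
  · exact hs (h ▸ Finset.mem_insert_self s I)
  · exact Finset.notMem_erase s I (h ▸ hs)

theorem IsCore.isAtomVia {s t : Fin n} (hq : IsCore I (M.erase t) q) (hM : M = insert s I)
    (hs : s ∉ I) (ht : t ∈ M) (hmem : longest M ∈ q) :
    ∃ i, IsAtomVia i I M (M.erase t) t s := by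
  have hcut : IsCut (M.erase t) _ t := ⟨Finset.notMem_erase t M, rfl⟩
  obtain ⟨u, h⟩ := exists_isAtomVia hcut
  rw [Finset.insert_erase ht] at h
  have hus : u = s := by
    by_contra hne
    have huI : u ∈ I := (Finset.mem_insert.1 (hM ▸ h.mem_left)).resolve_left hne
    have huM : simple u * longest M * 1 ∈ q :=
      hq.1.mul_mul_mem (simple_mem_parabolic huI) (one_mem _) hmem
    have hconj : (longest M)⁻¹ * (simple u * longest M * 1) = simple t := by
      rw [h.simple_eq_conj, mul_one, mul_assoc _ _ (longest M), longest_mul_self, mul_one,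
        inv_mul_cancel_left]
    have := hq.inv_mul_mem hmem huM
    rw [hconj, simple_mem_parabolic_iff] at this
    exact Finset.notMem_erase t M this
  obtain rfl := hus
  have hI : M.erase u = I := by rw [hM, Finset.erase_insert hs]
  exact ⟨_, hI ▸ h⟩

theorem IsAtomic.one_notMem (hq : IsAtomic I J q) : (1 : Equiv.Perm (Fin (n + 1))) ∉ q := by
  intro hone
  obtain ⟨hcore, s, t, -, ⟨-, hJ, hadj⟩, hmax, -⟩ := hq
  simp only [walk, List.getLast?_cons_cons, List.getLast?_singleton, Option.some.injEq,
    List.isChain_cons_cons, List.isChain_singleton, and_true] at hJ hadj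
  have ht : t ∈ insert s I := by
    by_contra h
    exact hadj.2.ne (Finset.erase_eq_of_notMem h).symm
  have hmem := hmax.1
  rw [walk, walk, walk, exprProd_of_subset_of_superset (Finset.subset_insert s I)
    (Finset.erase_subset t _)] at hmem
  have := hcore.inv_mul_mem hone hmem
  rw [inv_one, one_mul, ← hJ] at this
  exact longest_notMem_parabolic_erase ht this

theorem one_mem_of_exprProd_mem (hq : IsCoset I J q) (hI : M ⊆ I) (hJ : M ⊆ J)
    (hmem : exprProd [I, M, J] ∈ q) : 1 ∈ q := by
  rw [exprProd_cons_of_superset hI, exprProd_cons_of_subset hJ, exprProd] at hmem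
  convert hq.mul_mul_mem (inv_mem (mul_mem (longest_mem_parabolic I)
    (parabolic_mono hI (longest_mem_parabolic M)))) (inv_mem (longest_mem_parabolic J)) hmem using 1
  group

theorem IsAtomic.exists_isAtomVia (hq : IsAtomic I J q) (hr : IsReducedExpr I J q [I, M, J]) :
    ∃ i s t, IsAtomVia i I M J s t := by
  obtain ⟨-, ⟨-, -, hadj⟩, hmax, -⟩ := hr
  have hcard := hq.1.card_eq
  simp only [List.isChain_cons_cons, List.isChain_singleton, and_true] at hadj
  obtain ⟨⟨s, hs, hM⟩ | ⟨s, hs, rfl⟩, ⟨t, ht, rfl⟩ | ⟨t, ht, rfl⟩⟩ := hadj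
  · rw [Finset.card_insert_of_notMem ht, hM, Finset.card_insert_of_notMem hs] at hcard
    omega
  · have hmem := hmax.1
    rw [exprProd_of_subset_of_superset (hM ▸ Finset.subset_insert s I)
      (Finset.erase_subset t M)] at hmem
    obtain ⟨i, h⟩ := hq.1.isAtomVia hM hs ht hmem
    exact ⟨i, t, s, h⟩
  · exact absurd (one_mem_of_exprProd_mem hq.1.1 (Finset.erase_subset s I)
      (Finset.subset_insert t _) hmax.1) hq.one_notMem
  · have hI := Finset.card_erase_add_one hs
    have hJ := Finset.card_erase_add_one ht
    omega

end Core

/-! ### Words in the adjacent transpositions of the natural numbers -/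

/-- The permutation of `ℕ` expressed by a word: the product of the transpositions `(i i+1)` for
the letters `i` of the word. -/
def wordPerm : List ℕ → Equiv.Perm ℕ
  | [] => 1
  | i :: u => Equiv.swap i (i + 1) * wordPerm u

/-- A word is reduced if each letter adds an inversion to the product of the letters on its
right. -/
def IsReducedWord : List ℕ → Prop
  | [] => True
  | i :: u => (wordPerm u)⁻¹ i < (wordPerm u)⁻¹ (i + 1) ∧ IsReducedWord u

/-- A single application of a braid relation of the symmetric group inside a word. -/
inductive BraidMove : List ℕ → List ℕ → Prop
  | braid (i j : ℕ) (h : j = i + 1 ∨ i = j + 1) (u : List ℕ) :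
      BraidMove (i :: j :: i :: u) (j :: i :: j :: u)
  | comm (i j : ℕ) (h : i + 1 < j ∨ j + 1 < i) (u : List ℕ) : BraidMove (i :: j :: u) (j :: i :: u)
  | cons (i : ℕ) {u v : List ℕ} (h : BraidMove u v) : BraidMove (i :: u) (i :: v)

section Words

variable {i j : ℕ} {u v : List ℕ}

theorem wordPerm_cons_inv_apply (i : ℕ) (u : List ℕ) (m : ℕ) :
    (wordPerm (i :: u))⁻¹ m = (wordPerm u)⁻¹ (Equiv.swap i (i + 1) m) := by
  rw [wordPerm, mul_inv_rev, Equiv.swap_inv, Equiv.Perm.mul_apply]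

theorem swap_commute (h : i + 1 < j ∨ j + 1 < i) :
    Equiv.swap i (i + 1) * Equiv.swap j (j + 1) = Equiv.swap j (j + 1) * Equiv.swap i (i + 1) := by
  ext m
  simp only [Equiv.Perm.mul_apply, Equiv.swap_apply_def]
  split_ifs <;> omega

theorem swap_braid_succ (i : ℕ) :
    Equiv.swap i (i + 1) * (Equiv.swap (i + 1) (i + 1 + 1) * Equiv.swap i (i + 1)) =
      Equiv.swap (i + 1) (i + 1 + 1) * (Equiv.swap i (i + 1) *
        Equiv.swap (i + 1) (i + 1 + 1)) := by
  rw [← mul_assoc, ← mul_assoc, Equiv.swap_mul_swap_mul_swap (by omega) (by omega),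
    Equiv.swap_comm i (i + 1), Equiv.swap_comm (i + 1) (i + 1 + 1),
    Equiv.swap_mul_swap_mul_swap (by omega) (by omega), Equiv.swap_comm]

theorem swap_braid (h : j = i + 1 ∨ i = j + 1) :
    Equiv.swap i (i + 1) * (Equiv.swap j (j + 1) * Equiv.swap i (i + 1)) =
      Equiv.swap j (j + 1) * (Equiv.swap i (i + 1) * Equiv.swap j (j + 1)) := by
  rcases h with rfl | rfl
  exacts [swap_braid_succ i, (swap_braid_succ j).symm]

theorem swap_succ_apply_self (i : ℕ) : Equiv.swap (i + 1) (i + 1 + 1) i = i :=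
  Equiv.swap_apply_of_ne_of_ne (by omega) (by omega)

theorem swap_apply_succ_succ (i : ℕ) : Equiv.swap i (i + 1) (i + 1 + 1) = i + 1 + 1 :=
  Equiv.swap_apply_of_ne_of_ne (by omega) (by omega)

theorem swap_apply_of_far (h : i + 1 < j ∨ j + 1 < i) :
    Equiv.swap i (i + 1) j = j ∧ Equiv.swap i (i + 1) (j + 1) = j + 1 :=
  ⟨Equiv.swap_apply_of_ne_of_ne (by omega) (by omega),
    Equiv.swap_apply_of_ne_of_ne (by omega) (by omega)⟩

theorem BraidMove.wordPerm_eq (h : BraidMove u v) : wordPerm u = wordPerm v := by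
  induction h with
  | braid i j h u =>
    simp only [wordPerm]
    simpa only [mul_assoc] using congrArg (· * wordPerm u) (swap_braid h)
  | comm i j h u => simp only [wordPerm, ← mul_assoc, swap_commute h]
  | cons i _ ih => simp only [wordPerm, ih]

theorem BraidMove.isReducedWord (h : BraidMove u v) (hu : IsReducedWord u) : IsReducedWord v := by
  induction h with
  | braid i j h u =>
    simp only [IsReducedWord, wordPerm_cons_inv_apply] at hu ⊢
    rcases h with rfl | rfl
    all_goals
      simp only [Equiv.swap_apply_left, Equiv.swap_apply_right, swap_succ_apply_self,
        swap_apply_succ_succ] at hu ⊢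
      tauto
  | comm i j h u =>
    simp only [IsReducedWord, wordPerm_cons_inv_apply, swap_apply_of_far h,
      swap_apply_of_far h.symm] at hu ⊢
    tauto
  | cons i h ih =>
    simp only [IsReducedWord, ← h.wordPerm_eq] at hu ⊢
    exact ⟨hu.1, ih hu.2⟩

theorem BraidMove.length_eq (h : BraidMove u v) : u.length = v.length := by
  induction h with
  | cons i _ ih => simp only [List.length_cons, ih]
  | _ => rfl

/-- Equivalence of words under the braid relations. -/
abbrev BraidEquiv : List ℕ → List ℕ → Prop := Relation.ReflTransGen BraidMove

theorem BraidEquiv.cons (i : ℕ) (h : BraidEquiv u v) : BraidEquiv (i :: u) (i :: v) :=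
  Relation.ReflTransGen.lift (i :: ·) (fun _ _ => BraidMove.cons i) _ _ h

theorem BraidEquiv.wordPerm_eq (h : BraidEquiv u v) : wordPerm u = wordPerm v := by
  induction h with
  | refl => rfl
  | tail _ h ih => rw [ih, h.wordPerm_eq]

theorem BraidEquiv.isReducedWord (h : BraidEquiv u v) (hu : IsReducedWord u) :
    IsReducedWord v := by
  induction h with
  | refl => exact hu
  | tail _ h ih => exact h.isReducedWord ih

theorem BraidEquiv.length_eq (h : BraidEquiv u v) : u.length = v.length := by
  induction h with
  | refl => rfl
  | tail _ h ih => rw [ih, h.length_eq]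

theorem exists_braidEquiv_cons (u : List ℕ) (i : ℕ) (hu : IsReducedWord u)
    (hdesc : (wordPerm u)⁻¹ (i + 1) < (wordPerm u)⁻¹ i) : ∃ v, BraidEquiv u (i :: v) := by
  induction hk : u.length using Nat.strong_induction_on generalizing u i with
  | _ k ih =>
  subst hk
  match u with
  | [] => exact absurd hdesc (by simp [wordPerm])
  | j :: u =>
    obtain ⟨hj, hu⟩ := hu
    rw [wordPerm_cons_inv_apply, wordPerm_cons_inv_apply] at hdesc
    obtain rfl | hfar | hnear : i = j ∨ (j + 1 < i ∨ i + 1 < j) ∨ (j = i + 1 ∨ i = j + 1) := by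
      omega
    · exact ⟨u, .refl⟩
    · rw [(swap_apply_of_far hfar).1, (swap_apply_of_far hfar).2] at hdesc
      obtain ⟨v, hv⟩ := ih u.length (Nat.lt_succ_self _) u i hu hdesc rfl
      exact ⟨j :: v, (hv.cons j).tail (.comm j i hfar v)⟩
    · have hdesc_i : (wordPerm u)⁻¹ (i + 1) < (wordPerm u)⁻¹ i := by
        rcases hnear with rfl | rfl
        · rw [Equiv.swap_apply_left, swap_succ_apply_self] at hdesc
          exact hj.trans hdesc
        · rw [Equiv.swap_apply_right, swap_apply_succ_succ] at hdesc
          exact hdesc.trans hj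
      obtain ⟨v, hv⟩ := ih u.length (Nat.lt_succ_self _) u i hu hdesc_i rfl
      have hdesc_j : (wordPerm v)⁻¹ (j + 1) < (wordPerm v)⁻¹ j := by
        rw [hv.wordPerm_eq, wordPerm_cons_inv_apply, wordPerm_cons_inv_apply] at hdesc
        rcases hnear with rfl | rfl
        · rwa [Equiv.swap_apply_left, swap_succ_apply_self, swap_apply_succ_succ,
            Equiv.swap_apply_left] at hdesc
        · rwa [Equiv.swap_apply_right, swap_apply_succ_succ, swap_succ_apply_self,
            Equiv.swap_apply_right] at hdesc
      have hlen : v.length < (j :: u).length := by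
        simp only [List.length_cons, hv.length_eq]
        omega
      obtain ⟨v', hv'⟩ := ih v.length hlen v j (hv.isReducedWord hu).2 hdesc_j rfl
      exact ⟨j :: i :: v', (BraidEquiv.cons j (hv.trans (hv'.cons i))).tail
        (.braid j i hnear.symm v')⟩

theorem eq_nil_of_wordPerm_eq_one (hu : IsReducedWord u) (h : wordPerm u = 1) : u = [] := by
  match u with
  | [] => rfl
  | i :: u =>
    have hinv : (wordPerm u)⁻¹ = Equiv.swap i (i + 1) := (eq_inv_of_mul_eq_one_left h).symm
    have := hu.1
    rw [hinv, Equiv.swap_apply_left, Equiv.swap_apply_right] at this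
    omega

/-- Matsumoto's theorem for the symmetric group. -/
theorem braidEquiv_of_wordPerm_eq (hu : IsReducedWord u) (hv : IsReducedWord v)
    (h : wordPerm u = wordPerm v) : BraidEquiv u v := by
  induction v generalizing u with
  | nil => exact eq_nil_of_wordPerm_eq_one hu h ▸ .refl
  | cons i v ih =>
    have hdesc : (wordPerm u)⁻¹ (i + 1) < (wordPerm u)⁻¹ i := by
      rw [h, wordPerm_cons_inv_apply, wordPerm_cons_inv_apply, Equiv.swap_apply_right,
        Equiv.swap_apply_left]
      exact hv.1
    obtain ⟨u', hu'⟩ := exists_braidEquiv_cons u i hu hdesc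
    have hperm : wordPerm u' = wordPerm v := by
      have := hu'.wordPerm_eq.symm.trans h
      simpa only [wordPerm, mul_right_inj] using this
    exact hu'.trans ((ih (hu'.isReducedWord hu).2 hv.2 hperm).cons i)

end Words

section AtomWords

variable {n : ℕ} {I I' J K L M : Finset (Fin n)} {E T T' : List (Finset (Fin n))}
  {u v : List ℕ}

/-! ### Expressions of words of atoms -/

theorem IsAtomVia.isAtom {i : ℕ} {s t : Fin n} (h : IsAtomVia i I M K s t) : IsAtom i I M K :=
  isAtom_iff.2 ⟨s, t, h⟩

theorem IsAtomVia.cancelledInversions_eq_zero_iff {i : ℕ} {s t : Fin n}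
    (h : IsAtomVia i I M K s t) {π : Equiv.Perm ℕ} {z : Equiv.Perm (Fin (n + 1))}
    (hz : ∀ p, blockIndex K (z p) = π (blockIndex J p)) :
    cancelledInversions (longest M * longest K) z = 0 ↔ π⁻¹ i < π⁻¹ (i + 1) := by
  have hmap := h.permutesBlocks.blockIndex_apply
  have hzinv (p : Fin (n + 1)) : π⁻¹ (blockIndex K p) = blockIndex J (z⁻¹ p) := by
    rw [Equiv.Perm.inv_eq_iff_eq, ← hz, Equiv.Perm.coe_inv, Equiv.apply_symm_apply]
  have hs := hzinv s.castSucc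
  have hs' := hzinv s.succ
  rw [h.isCut.2] at hs
  rw [h.isCut.blockIndex_succ] at hs'
  rw [AtomicCoset.cancelledInversions_eq_zero_iff]
  constructor
  · intro hcancel
    by_contra! hle
    have hlt := lt_of_le_of_ne hle (π⁻¹.injective.ne (by omega))
    rw [hs, hs'] at hlt
    have hinc := hcancel (z⁻¹ s.succ) (z⁻¹ s.castSucc) (lt_of_blockIndex_lt hlt)
    simp only [Equiv.Perm.coe_inv, Equiv.apply_symm_apply] at hinc
    have hmono := blockIndex_mono I (hinc Fin.castSucc_lt_succ).le
    rw [hmap, hmap, h.isCut.blockIndex_succ, h.isCut.2, Equiv.swap_apply_left,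
      Equiv.swap_apply_right] at hmono
    omega
  · intro hlt p q hpq hzlt
    rcases (blockIndex_mono K hzlt.le).eq_or_lt with hb | hb
    · exact h.permutesBlocks.increasing.lt hb hzlt
    · by_contra! hle
      have hmono := blockIndex_mono I hle
      rw [hmap, hmap, Equiv.swap_apply_def, Equiv.swap_apply_def] at hmono
      obtain ⟨hq, hp⟩ : blockIndex K (z q) = i ∧ blockIndex K (z p) = i + 1 := by
        split_ifs at hmono <;> omega
      rw [← hp, ← hq, hzinv, hzinv, Equiv.Perm.coe_inv, Equiv.symm_apply_apply,
        Equiv.symm_apply_apply] at hlt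
      exact (lt_of_blockIndex_lt hlt).not_gt hpq

namespace IsAtomWord

theorem permutesBlocks (h : IsAtomWord J u (I :: T)) :
    PermutesBlocks I J (wordPerm u) (exprProd (I :: T) * longest J) := by
  generalize hE : I :: T = E at h
  induction h generalizing I T with
  | nil =>
    obtain ⟨rfl, rfl⟩ := List.cons.inj hE
    rw [exprProd, longest_mul_self]
    exact .one _
  | cons i u I' M K E h _ ih =>
    obtain ⟨rfl, rfl⟩ := List.cons.inj hE
    obtain ⟨s, t, h⟩ := isAtom_iff.1 h
    rw [h.exprProd_cons, mul_assoc]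
    exact h.permutesBlocks.mul (ih rfl)

theorem blockIndex_exprProd_apply (h : IsAtomWord J u (I :: T)) (p : Fin (n + 1)) :
    blockIndex I (exprProd (I :: T) p) = wordPerm u (blockIndex J p) := by
  have := h.permutesBlocks.blockIndex_apply (longest J p)
  rwa [Equiv.Perm.mul_apply, longest_longest_apply, blockIndex_longest_apply] at this

theorem length_exprProd_le_and_eq_iff (h : IsAtomWord J u E) :
    (length (exprProd E) : ℤ) ≤ exprLength E ∧
      ((length (exprProd E) : ℤ) = exprLength E ↔ IsReducedWord u) := by
  induction h with
  | nil => simp only [exprProd, exprLength, IsReducedWord, le_refl, and_self]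
  | cons i u I M K E h hE ih =>
    obtain ⟨s, t, h⟩ := isAtom_iff.1 h
    have hlen := length_add_length (longest M * longest K) (exprProd (K :: E))
    have hcancel := h.cancelledInversions_eq_zero_iff hE.blockIndex_exprProd_apply
    rw [h.exprProd_cons, h.exprLength_cons, IsReducedWord, ← ih.2, ← hcancel]
    omega

theorem length_exprProd_eq (h : IsAtomWord J u E) (hu : IsReducedWord u) :
    (length (exprProd E) : ℤ) = exprLength E :=
  h.length_exprProd_le_and_eq_iff.2.2 hu

theorem isExpression (h : IsAtomWord J u (I :: T)) : IsExpression I J (I :: T) := by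
  generalize hE : I :: T = E at h
  induction h generalizing I T with
  | nil =>
    obtain ⟨rfl, rfl⟩ := List.cons.inj hE
    exact ⟨rfl, rfl, .singleton _⟩
  | cons i _ I' M K E h _ ih =>
    obtain ⟨rfl, rfl⟩ := List.cons.inj hE
    obtain ⟨s, t, h⟩ := isAtom_iff.1 h
    obtain ⟨-, hlast, hchain⟩ := ih rfl
    refine ⟨rfl, by rw [List.getLast?_cons_cons, List.getLast?_cons_cons, hlast], ?_⟩
    rw [List.isChain_cons_cons, List.isChain_cons_cons]
    exact ⟨h.adjacent_left, h.adjacent_right, hchain⟩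

theorem isAtomicExpr (h : IsAtomWord J u E) : IsAtomicExpr E := by
  induction h with
  | nil => exact .nil J
  | cons i _ I M K E h _ ih =>
    obtain ⟨s, t, h⟩ := isAtom_iff.1 h
    exact .cons I M K E _ h.isAtomic h.isReducedExpr ih

end IsAtomWord

theorem coset_mul_longest (I J : Finset (Fin n)) (x : Equiv.Perm (Fin (n + 1))) :
    coset I J (x * longest J) = coset I J x :=
  DoubleCoset.doubleCoset_eq_of_mem
    (DoubleCoset.mem_doubleCoset.2 ⟨1, one_mem _, _, longest_mem_parabolic J, by rw [one_mul]⟩)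

namespace IsAtomWord

theorem isMaxElt (h : IsAtomWord J u (I :: T)) :
    IsMaxElt (coset I J (exprProd (I :: T))) (exprProd (I :: T)) := by
  have := h.permutesBlocks.isMaxElt
  rwa [coset_mul_longest, mul_assoc, longest_mul_self, mul_one] at this

theorem isCore (h : IsAtomWord J u (I :: T)) : IsCore I J (coset I J (exprProd (I :: T))) :=
  coset_mul_longest I J _ ▸ h.permutesBlocks.isCore

theorem isAtomicReducedExpr (h : IsAtomWord J u (I :: T)) (hu : IsReducedWord u) :
    IsAtomicReducedExpr I J (coset I J (exprProd (I :: T))) (I :: T) :=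
  ⟨⟨⟨_, rfl⟩, h.isExpression, h.isMaxElt, h.length_exprProd_eq hu⟩, h.isAtomicExpr⟩

theorem left_eq (h : IsAtomWord J u (I :: T)) (h' : IsAtomWord J v (I' :: T'))
    (huv : wordPerm u = wordPerm v) : I = I' :=
  h.permutesBlocks.left_eq (huv ▸ h'.permutesBlocks)

theorem exprProd_eq (h : IsAtomWord J u (I :: T)) (h' : IsAtomWord J v (I' :: T'))
    (huv : wordPerm u = wordPerm v) : exprProd (I :: T) = exprProd (I' :: T') :=
  mul_right_cancel (h.permutesBlocks.perm_eq (huv ▸ h'.permutesBlocks))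

theorem append {X : List (Finset (Fin n))} (hX : IsAtomWord K u X)
    (hT : IsAtomWord J v (K :: T)) : IsAtomWord J (u ++ v) (X ++ T) := by
  induction hX with
  | nil => exact hT
  | cons i u I M L E h _ ih => exact .cons _ _ _ _ _ _ h ih

end IsAtomWord

theorem IsAtomicExpr.exists_word (h : IsAtomicExpr E) (hJ : E.getLast? = some J) :
    ∃ u, IsAtomWord J u E := by
  induction h with
  | nil I =>
    obtain rfl : I = J := Option.some.inj hJ
    exact ⟨[], .nil⟩
  | cons I M K E q hq hr _ ih =>
    obtain ⟨u, hu⟩ := ih (by rwa [List.getLast?_cons_cons, List.getLast?_cons_cons] at hJ)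
    obtain ⟨i, s, t, h⟩ := hq.exists_isAtomVia hr
    exact ⟨i :: u, .cons i u I M K E h.isAtom hu⟩

theorem IsAtomicReducedExpr.exists_word {p : Set (Equiv.Perm (Fin (n + 1)))}
    (h : IsAtomicReducedExpr I J p E) :
    ∃ u T, E = I :: T ∧ IsAtomWord J u (I :: T) ∧ IsReducedWord u ∧
      p = coset I J (exprProd (I :: T)) := by
  obtain ⟨⟨⟨w, rfl⟩, ⟨hhead, hlast, -⟩, hmax, hlen⟩, hatomic⟩ := h
  obtain ⟨u, hu⟩ := hatomic.exists_word hlast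
  obtain ⟨T, rfl⟩ := List.head?_eq_some_iff.1 hhead
  exact ⟨u, T, rfl, hu, hu.length_exprProd_le_and_eq_iff.2.1 hlen,
    (DoubleCoset.doubleCoset_eq_of_mem hmax.1).symm⟩

/-! ### The two sides of an atomic braid relation -/

/-- The expression `[I + a - b + c - d + b - e]` of the composite `a_k a_l a_k^J` for adjacent `k`
and `l`, passing through `K` and `L`. The last field says that `d` is already the `l`-th element of
`S \ J`, so that the other side `a_l a_k a_l^J` of the relation starts by removing `d`. -/
structure BraidPath (k l : ℕ) (I K L J : Finset (Fin n)) (a b c d e : Fin n) : Prop where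
  near : l = k + 1 ∨ k = l + 1
  left : IsAtomVia k I (insert b K) K b a
  middle : IsAtomVia l K (insert d L) L d c
  right : IsAtomVia k L (insert e J) J e b
  cut : IsCut J l d

/-- The expression `[I + a - b + c - d]` of the composite `a_k a_l^J` for distant `k` and `l`,
passing through `K`. The last field says that `b` is already the `k`-th element of `S \ J`. -/
structure CommPath (k l : ℕ) (I K J : Finset (Fin n)) (a b c d : Fin n) : Prop where
  far : k + 1 < l ∨ l + 1 < k
  left : IsAtomVia k I (insert b K) K b a
  right : IsAtomVia l K (insert d J) J d c
  cut : IsCut J k b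

section Paths

variable {k l : ℕ} {a b c d e : Fin n}

theorem BraidPath.walk_eq (h : BraidPath k l I K L J a b c d e) :
    walk I [add a, sub b, add c, sub d, add b, sub e] =
      [I, insert b K, K, insert d L, L, insert e J, J] := by
  rw [h.left.walk_cons, h.middle.walk_cons, h.right.walk_cons, walk]

theorem CommPath.walk_eq (h : CommPath k l I K J a b c d) :
    walk I [add a, sub b, add c, sub d] = [I, insert b K, K, insert d J, J] := by
  rw [h.left.walk_cons, h.right.walk_cons, walk]

theorem BraidPath.isAtomWord (h : BraidPath k l I K L J a b c d e) :
    IsAtomWord J [k, l, k] (walk I [add a, sub b, add c, sub d, add b, sub e]) :=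
  h.walk_eq ▸ .cons _ _ _ _ _ _ h.left.isAtom
    (.cons _ _ _ _ _ _ h.middle.isAtom (.cons _ _ _ _ _ _ h.right.isAtom .nil))

theorem CommPath.isAtomWord (h : CommPath k l I K J a b c d) :
    IsAtomWord J [k, l] (walk I [add a, sub b, add c, sub d]) :=
  h.walk_eq ▸ .cons _ _ _ _ _ _ h.left.isAtom (.cons _ _ _ _ _ _ h.right.isAtom .nil)

theorem BraidPath.isCut_left (h : BraidPath k l I K L J a b c d e) : IsCut I l c :=
  h.left.isCut_of_ne h.middle.isCut_left (by have := h.near; omega)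

theorem CommPath.isCut_left (h : CommPath k l I K J a b c d) : IsCut I l c :=
  h.left.isCut_of_ne h.right.isCut_left (by have := h.far; omega)

theorem exists_braidPath (near : l = k + 1 ∨ k = l + 1) (he : IsCut J k e) (hd : IsCut J l d) :
    ∃ I K L a b c, BraidPath k l I K L J a b c d e := by
  obtain ⟨b, hright⟩ := exists_isAtomVia he
  obtain ⟨c, hmiddle⟩ := exists_isAtomVia (hright.isCut_of_ne hd (by omega))
  obtain ⟨a, hleft⟩ := exists_isAtomVia (hmiddle.isCut_of_ne hright.isCut_left (by omega))
  exact ⟨_, _, _, a, b, c, near, hleft, hmiddle, hright, hd⟩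

theorem exists_commPath (far : k + 1 < l ∨ l + 1 < k) (hb : IsCut J k b) (hd : IsCut J l d) :
    ∃ I K a c, CommPath k l I K J a b c d := by
  obtain ⟨c, hright⟩ := exists_isAtomVia hd
  obtain ⟨a, hleft⟩ := exists_isAtomVia (hright.isCut_of_ne hb (by omega))
  exact ⟨_, _, a, c, far, hleft, hright, hb⟩

theorem exists_braidPaths (near : l = k + 1 ∨ k = l + 1) (he : IsCut J k e) (hd : IsCut J l d) :
    ∃ I K L K' L' a b c f, BraidPath k l I K L J a b c d e ∧ BraidPath l k I K' L' J c f a e d := by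
  obtain ⟨I, K, L, a, b, c, h⟩ := exists_braidPath near he hd
  obtain ⟨I', K', L', c', f, a', h'⟩ := exists_braidPath near.symm hd he
  obtain rfl : I = I' :=
    h.isAtomWord.left_eq h'.isAtomWord (BraidMove.braid k l near []).wordPerm_eq
  obtain rfl := h.left.isCut_left.unique h'.isCut_left
  obtain rfl := h.isCut_left.unique h'.left.isCut_left
  exact ⟨I, K, L, K', L', a, b, c, f, h, h'⟩

theorem exists_commPaths (far : k + 1 < l ∨ l + 1 < k) (hb : IsCut J k b) (hd : IsCut J l d) :
    ∃ I K K' a c, CommPath k l I K J a b c d ∧ CommPath l k I K' J c d a b := by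
  obtain ⟨I, K, a, c, h⟩ := exists_commPath far hb hd
  obtain ⟨I', K', c', a', h'⟩ := exists_commPath far.symm hd hb
  obtain rfl : I = I' := h.isAtomWord.left_eq h'.isAtomWord (BraidMove.comm k l far []).wordPerm_eq
  obtain rfl := h.left.isCut_left.unique h'.isCut_left
  obtain rfl := h.isCut_left.unique h'.left.isCut_left
  exact ⟨I, K, K', a, c, h, h'⟩

end Paths

end AtomWords

section AtomicBraids

variable {n : ℕ} {I J K M : Finset (Fin n)} {E F T : List (Finset (Fin n))} {u v w : List ℕ}

/-! ### Atomic braid relations connect atomic reduced expressions -/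

theorem IsAtomVia.unique {i : ℕ} {I' M' : Finset (Fin n)} {s s' t t' : Fin n}
    (h : IsAtomVia i I M K s t) (h' : IsAtomVia i I' M' K s' t') : I = I' ∧ M = M' := by
  obtain rfl := h.isCut.unique h'.isCut
  obtain rfl : M = M' := h.eq_insert.trans h'.eq_insert.symm
  obtain rfl := simple_injective (h.simple_eq_conj.trans h'.simple_eq_conj.symm)
  exact ⟨h.eq_erase.trans h'.eq_erase.symm, rfl⟩

namespace IsAtomWord

theorem unique (h : IsAtomWord J u E) (h' : IsAtomWord J u F) : E = F := by
  induction h generalizing F with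
  | nil => cases h'; rfl
  | cons i u I M K E h _ ih =>
    cases h' with
    | cons _ _ I' M' K' E' h' hE' =>
      obtain ⟨rfl, rfl⟩ := List.cons.inj (ih hE')
      obtain ⟨s, t, h⟩ := isAtom_iff.1 h
      obtain ⟨s', t', h'⟩ := isAtom_iff.1 h'
      obtain ⟨rfl, rfl⟩ := h.unique h'
      rfl

theorem card_compl_eq (h : IsAtomWord J u (K :: T)) : Kᶜ.card = Jᶜ.card := by
  generalize hE : K :: T = E at h
  induction h generalizing K T with
  | nil => rw [(List.cons.inj hE).1]
  | cons i _ I M L E h _ ih =>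
    obtain ⟨s, t, h⟩ := isAtom_iff.1 h
    rw [(List.cons.inj hE).1, h.card_compl_eq, ih rfl]

theorem one_le_and_le_card_compl (h : IsAtomWord J u E) : ∀ i ∈ u, 1 ≤ i ∧ i ≤ Jᶜ.card := by
  induction h with
  | nil => exact List.forall_mem_nil _
  | cons i u I M K E h hE ih =>
    obtain ⟨s, t, h⟩ := isAtom_iff.1 h
    exact List.forall_mem_cons.2 ⟨⟨h.isCut.one_le, hE.card_compl_eq ▸ h.isCut.le_card_compl⟩, ih⟩

theorem exists_append (h : IsAtomWord J (u ++ v) E) :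
    ∃ K X T, IsAtomWord K u X ∧ IsAtomWord J v (K :: T) ∧ E = X ++ T := by
  induction u generalizing E with
  | nil =>
    cases E with
    | nil => cases h
    | cons K T => exact ⟨K, [K], T, .nil, h, rfl⟩
  | cons i u ih =>
    cases h with
    | cons _ _ I M L E h hE =>
      obtain ⟨K, X, T, hX, hT, hEXT⟩ := ih hE
      cases X with
      | nil => cases hX
      | cons L' X =>
        obtain ⟨rfl, rfl⟩ := List.cons.inj hEXT
        exact ⟨K, I :: M :: L :: X, T, .cons _ _ _ _ _ _ h hX, hT, rfl⟩

theorem replace_append (h : IsAtomWord J (u ++ w) E)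
    (huv : ∀ K : Finset (Fin n), (∀ i ∈ u, 1 ≤ i ∧ i ≤ Kᶜ.card) →
      ∃ I X Y, IsAtomWord K u (I :: X) ∧ IsAtomWord K v (I :: Y)) :
    ∃ K X Y T, IsAtomWord K u X ∧ IsAtomWord K v Y ∧ IsAtomWord J (v ++ w) (Y ++ T) ∧
      E = X ++ T ∧ (Y ++ T).head? = E.head? := by
  obtain ⟨K, X, T, hX, hT, rfl⟩ := h.exists_append
  obtain ⟨I, X', Y, hX', hY⟩ := huv K hX.one_le_and_le_card_compl
  obtain rfl := hX.unique hX'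
  exact ⟨K, _, _, T, hX, hY, hY.append hT, rfl, rfl⟩

end IsAtomWord

section

variable {k l : ℕ}

theorem exists_isAtomWord_braid (near : l = k + 1 ∨ k = l + 1)
    (hbound : ∀ i ∈ [k, l, k], 1 ≤ i ∧ i ≤ Jᶜ.card) :
    ∃ I X Y, IsAtomWord J [k, l, k] (I :: X) ∧ IsAtomWord J [l, k, l] (I :: Y) := by
  simp only [List.forall_mem_cons] at hbound
  obtain ⟨e, he⟩ := exists_isCut hbound.1.1 hbound.1.2
  obtain ⟨d, hd⟩ := exists_isCut hbound.2.1.1 hbound.2.1.2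
  obtain ⟨I, K, L, K', L', a, b, c, f, h, h'⟩ := exists_braidPaths near he hd
  exact ⟨I, _, _, h.walk_eq ▸ h.isAtomWord, h'.walk_eq ▸ h'.isAtomWord⟩

theorem exists_isAtomWord_comm (far : k + 1 < l ∨ l + 1 < k)
    (hbound : ∀ i ∈ [k, l], 1 ≤ i ∧ i ≤ Jᶜ.card) :
    ∃ I X Y, IsAtomWord J [k, l] (I :: X) ∧ IsAtomWord J [l, k] (I :: Y) := by
  simp only [List.forall_mem_cons] at hbound
  obtain ⟨b, hb⟩ := exists_isCut hbound.1.1 hbound.1.2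
  obtain ⟨d, hd⟩ := exists_isCut hbound.2.1.1 hbound.2.1.2
  obtain ⟨I, K, K', a, c, h, h'⟩ := exists_commPaths far hb hd
  exact ⟨I, _, _, h.walk_eq ▸ h.isAtomWord, h'.walk_eq ▸ h'.isAtomWord⟩

end

theorem InContext.cons {R : List (Finset (Fin n)) → List (Finset (Fin n)) → Prop}
    (h : InContext R E F) (I : Finset (Fin n)) : InContext R (I :: E) (I :: F) := by
  obtain ⟨A, X, Y, B, h, rfl, rfl⟩ := h
  exact ⟨I :: A, X, Y, B, h, rfl, rfl⟩

theorem IsAtomWord.exists_of_braidMove (h : IsAtomWord J u E) (huv : BraidMove u v) :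
    ∃ F, IsAtomWord J v F ∧ F.head? = E.head? ∧
      (InContext AtomicBraid E F ∨ InContext AtomicBraid F E) := by
  induction huv generalizing E with
  | braid i j near u =>
    obtain ⟨K, X, Y, T, hX, hY, hF, rfl, hhead⟩ := h.replace_append (u := [i, j, i])
      (v := [j, i, j]) fun _ => exists_isAtomWord_braid near
    refine ⟨_, hF, hhead, ?_⟩
    rcases near with rfl | rfl
    exacts [Or.inl ⟨[], X, Y, T, .braid K i X Y hX hY, rfl, rfl⟩,
      Or.inr ⟨[], Y, X, T, .braid K j Y X hY hX, rfl, rfl⟩]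
  | comm i j far u =>
    obtain ⟨K, X, Y, T, hX, hY, hF, rfl, hhead⟩ := h.replace_append (u := [i, j])
      (v := [j, i]) fun _ => exists_isAtomWord_comm far
    exact ⟨_, hF, hhead, Or.inl ⟨[], X, Y, T, .comm K i j far X Y hX hY, rfl, rfl⟩⟩
  | cons i _ ih =>
    cases h with
    | cons _ _ I M K E h hE =>
      obtain ⟨F, hF, hhead, hmove⟩ := ih hE
      obtain ⟨F, rfl⟩ := List.head?_eq_some_iff.1 hhead
      exact ⟨I :: M :: K :: F, .cons _ _ _ _ _ _ h hF, rfl,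
        hmove.imp (fun h => (h.cons M).cons I) (fun h => (h.cons M).cons I)⟩

theorem reflTransGen_atomicMove_of_braidEquiv (h : BraidEquiv u v) (hu : IsReducedWord u)
    (hE : IsAtomWord J u (I :: E)) (hF : IsAtomWord J v (I :: F)) :
    Relation.ReflTransGen (AtomicMove I J (coset I J (exprProd (I :: E)))) (I :: E) (I :: F) := by
  induction h using Relation.ReflTransGen.head_induction_on generalizing E with
  | refl => rw [hE.unique hF]
  | head hmove _ ih =>
    obtain ⟨G, hG, hhead, hEG⟩ := hE.exists_of_braidMove hmove
    obtain ⟨G, rfl⟩ := List.head?_eq_some_iff.1 hhead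
    have hred := hmove.isReducedWord hu
    have hprod := hE.exprProd_eq hG hmove.wordPerm_eq
    exact .head ⟨hE.isAtomicReducedExpr hu, hprod ▸ hG.isAtomicReducedExpr hred, hEG⟩
      (hprod ▸ ih hred hG)

theorem exists_blockIndex_eq {m : ℕ} (h1 : 1 ≤ m) (h2 : m ≤ Jᶜ.card + 1) :
    ∃ p, blockIndex J p = m := by
  rcases h2.eq_or_lt with rfl | h2
  · exact ⟨_, blockIndex_last J⟩
  · obtain ⟨r, hr⟩ := exists_isCut h1 (Nat.lt_succ_iff.1 h2)
    exact ⟨_, hr.2⟩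

theorem wordPerm_apply_of_notMem {m : ℕ} (h : ∀ i ∈ u, m ≠ i ∧ m ≠ i + 1) : wordPerm u m = m := by
  induction u with
  | nil => rfl
  | cons i u ih =>
    obtain ⟨hi, hu⟩ := List.forall_mem_cons.1 h
    rw [wordPerm, Equiv.Perm.mul_apply, ih hu, Equiv.swap_apply_of_ne_of_ne hi.1 hi.2]

theorem IsAtomWord.wordPerm_eq (hE : IsAtomWord J u (I :: E)) (hF : IsAtomWord J v (I :: F))
    (h : coset I J (exprProd (I :: E)) = coset I J (exprProd (I :: F))) :
    wordPerm u = wordPerm v := by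
  have hmin : exprProd (I :: F) * longest J = exprProd (I :: E) * longest J := by
    refine hE.permutesBlocks.eq_of_mem_coset ?_ hF.permutesBlocks.increasing
    rw [coset_mul_longest, h, ← coset_mul_longest]
    exact DoubleCoset.mem_doubleCoset_self ..
  ext m
  by_cases hm : 1 ≤ m ∧ m ≤ Jᶜ.card + 1
  · obtain ⟨q, rfl⟩ := exists_blockIndex_eq hm.1 hm.2
    rw [← hE.permutesBlocks.blockIndex_apply, ← hF.permutesBlocks.blockIndex_apply, hmin]
  · rw [wordPerm_apply_of_notMem fun i hi => ?_, wordPerm_apply_of_notMem fun i hi => ?_]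
    · have := hF.one_le_and_le_card_compl i hi
      omega
    · have := hE.one_le_and_le_card_compl i hi
      omega

theorem reflTransGen_atomicMove {p : Set (Equiv.Perm (Fin (n + 1)))}
    (hEp : IsAtomicReducedExpr I J p E) (hFp : IsAtomicReducedExpr I J p F) :
    Relation.ReflTransGen (AtomicMove I J p) E F := by
  obtain ⟨u, E, rfl, hE, hu, rfl⟩ := hEp.exists_word
  obtain ⟨v, F, rfl, hF, hv, hp⟩ := hFp.exists_word
  exact reflTransGen_atomicMove_of_braidEquiv
    (braidEquiv_of_wordPerm_eq hu hv (hE.wordPerm_eq hF hp)) hu hE hF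

end AtomicBraids

section Switchbacks

variable {n : ℕ} {I J K L M N Q : Finset (Fin n)} {E T : List (Finset (Fin n))} {w : List ℕ}
  {x : Equiv.Perm (Fin (n + 1))} {π : Equiv.Perm ℕ} {k l : ℕ} {a c d e u v : Fin n}

/-! ### Extending expressions on the right -/

theorem exprProd_append_singleton (hL : E.getLast? = some L) (N : Finset (Fin n)) :
    exprProd (E ++ [N]) = exprProd E * (longest L)⁻¹ * longest (L ∪ N) := by
  induction E with
  | nil => cases hL
  | cons I E ih =>
    cases E with
    | nil =>
      obtain rfl : I = L := Option.some.inj hL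
      simp only [List.singleton_append, exprProd]
      group
    | cons K E =>
      rw [List.getLast?_cons_cons] at hL
      rw [List.cons_append, List.cons_append, exprProd, ← List.cons_append, ih hL, exprProd]
      simp only [mul_assoc]

theorem exprLength_append_singleton (hL : E.getLast? = some L) (N : Finset (Fin n)) :
    exprLength (E ++ [N]) = exprLength E - length (longest L) + length (longest (L ∪ N)) := by
  induction E with
  | nil => cases hL
  | cons I E ih =>
    cases E with
    | nil =>
      obtain rfl : I = L := Option.some.inj hL
      simp only [List.singleton_append, exprLength]
      ring
    | cons K E =>
      rw [List.getLast?_cons_cons] at hL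
      rw [List.cons_append, List.cons_append, exprLength, ← List.cons_append, ih hL, exprLength]
      ring

theorem IsExpression.extend (h : IsExpression K L E) (hM : Adjacent M K) (hN : Adjacent L N) :
    IsExpression M N ([M] ++ E ++ [N]) := by
  obtain ⟨hhead, hlast, hchain⟩ := h
  refine ⟨rfl, List.getLast?_concat, List.isChain_append.2 ⟨?_, .singleton _, ?_⟩⟩
  · refine List.isChain_append.2 ⟨.singleton _, hchain, ?_⟩
    simp [hhead, hM]
  · rw [List.getLast?_append, hlast]
    simp [hN]

theorem exprProd_mem_parabolic (h : ∀ N ∈ E, N ⊆ Q) : exprProd E ∈ parabolic Q := by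
  have hmem (N : Finset (Fin n)) (hN : N ⊆ Q) : longest N ∈ parabolic Q :=
    parabolic_mono hN (longest_mem_parabolic N)
  induction E with
  | nil => exact one_mem _
  | cons I E ih =>
    rw [List.forall_mem_cons] at h
    cases E with
    | nil => exact hmem I h.1
    | cons K E =>
      have hK := h.2 K List.mem_cons_self
      exact mul_mem (mul_mem (hmem _ (Finset.union_subset h.1 hK)) (inv_mem (hmem K hK))) (ih h.2)

/-! ### Expressions of longest elements -/

theorem IsAtomWord.exprProd_eq_longest (h : IsAtomWord J w (I :: T))
    (hmem : exprProd (I :: T) ∈ parabolic Q)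
    (hQ : ∀ r ∈ Q, r ∉ J →
      wordPerm w (blockIndex J r.succ) < wordPerm w (blockIndex J r.castSucc)) :
    exprProd (I :: T) = longest Q := by
  refine eq_longest_of_decreasingOnBlocks (blockIndex_apply hmem) fun r hr => ?_
  by_cases hrJ : r ∈ J
  · have hb : blockIndex J (longest J r.succ) = blockIndex J (longest J r.castSucc) := by
      rw [blockIndex_longest_apply, blockIndex_longest_apply, blockIndex_succ_of_mem hrJ]
    have := h.permutesBlocks.increasing.lt hb (decreasingOnBlocks_longest J r hrJ)
    rwa [Equiv.Perm.mul_apply, Equiv.Perm.mul_apply, longest_longest_apply,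
      longest_longest_apply] at this
  · refine lt_of_blockIndex_lt (J := I) ?_
    rw [h.blockIndex_exprProd_apply, h.blockIndex_exprProd_apply]
    exact hQ r hr hrJ

theorem isReducedExpr_of_exprProd_eq_longest (hI : I ⊆ Q) (hJ : J ⊆ Q)
    (hE : IsExpression I J E) (hprod : exprProd E = longest Q)
    (hlen : exprLength E = length (longest Q)) :
    IsReducedExpr I J (coset I J (longest Q)) E := by
  refine ⟨⟨_, rfl⟩, hE, ⟨hprod ▸ DoubleCoset.mem_doubleCoset_self _ _ _, fun y hy => ?_⟩,
    by rw [hprod, hlen]⟩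
  obtain ⟨a, ha, b, hb, rfl⟩ := DoubleCoset.mem_doubleCoset.1 hy
  rw [hprod]
  exact length_le_length_longest (mul_mem (mul_mem (parabolic_mono hI ha)
    (longest_mem_parabolic Q)) (parabolic_mono hJ hb))

theorem exprProd_trim (hI : I ⊆ M) (hJ : J ⊆ N) :
    exprProd (I :: M :: E ++ [N, J]) = exprProd (M :: E ++ [N]) := by
  have := exprProd_append_singleton (E := I :: M :: E ++ [N]) List.getLast?_concat J
  rw [List.append_assoc, List.singleton_append] at this
  rw [this, Finset.union_eq_left.2 hJ, inv_mul_cancel_right]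
  exact exprProd_cons_of_subset hI _

theorem exprLength_trim (hI : I ⊆ M) (hJ : J ⊆ N) :
    exprLength (I :: M :: E ++ [N, J]) = exprLength (M :: E ++ [N]) := by
  have := exprLength_append_singleton (E := I :: M :: E ++ [N]) List.getLast?_concat J
  rw [List.append_assoc, List.singleton_append] at this
  rw [this, Finset.union_eq_left.2 hJ, sub_add_cancel]
  exact exprLength_cons_of_subset hI _

theorem isReducedExpr_erase_erase (hc : c ∈ Q) (hd : d ∈ Q) :
    IsReducedExpr (Q.erase c) (Q.erase d) (coset (Q.erase c) (Q.erase d) (longest Q))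
      [Q.erase c, Q, Q.erase d] := by
  have hcQ := Finset.erase_subset c Q
  have hdQ := Finset.erase_subset d Q
  refine isReducedExpr_of_exprProd_eq_longest hcQ hdQ ⟨rfl, rfl, ?_⟩
    (exprProd_of_subset_of_superset hcQ hdQ) ?_
  · have hadj : Adjacent (Q.erase c) Q := by
      simpa only [Finset.insert_erase hc] using Adjacent.insert (Finset.notMem_erase c Q)
    simp [hadj, Adjacent.erase hd]
  · rw [exprLength_cons_of_subset hcQ, exprLength_cons_of_superset hdQ, exprLength]
    ring

/-! ### Redundancies -/

theorem PermutesBlocks.mem_of_simple_eq_conj (h : PermutesBlocks K L π x)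
    (hst : simple c = x * simple d * x⁻¹) (hd : d ∈ L) : c ∈ K := by
  obtain ⟨s, hs, heq⟩ := h.exists_simple_eq_conj hd
  rwa [simple_injective (hst.trans heq.symm)]

theorem PermutesBlocks.leftRed_insert (h : PermutesBlocks K L π x) (hu : IsCut K k u)
    (hv : IsCut L l v) (hlt : π l < π (l + 1)) (hne : ¬(π l = k ∧ π (l + 1) = k + 1)) :
    leftRed (insert u K) (insert v L) x = K := by
  classical
  ext s
  simp only [leftRed, Finset.mem_filter]
  constructor
  · rintro ⟨hs, t, ht, hst⟩
    refine (Finset.mem_insert.1 hs).resolve_left fun hsu => ?_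
    subst hsu
    refine hu.1 (h.mem_of_simple_eq_conj hst ((Finset.mem_insert.1 ht).resolve_left fun htv => ?_))
    subst htv
    have hcast := h.blockIndex_apply t.castSucc
    have hsucc := h.blockIndex_apply t.succ
    rw [hv.2] at hcast
    rw [hv.blockIndex_succ] at hsucc
    rw [conj_simple, simple_eq_swap_iff] at hst
    rcases hst with ⟨hc, hs⟩ | ⟨hc, hs⟩ <;> rw [hc] at hcast <;> rw [hs] at hsucc <;>
      rw [hu.2, hu.blockIndex_succ] at * <;> omega
  · intro hs
    obtain ⟨t, ht, hts⟩ := h.exists_simple_eq_conj_inv hs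
    exact ⟨Finset.mem_insert_of_mem hs, t, Finset.mem_insert_of_mem ht, by rw [hts]; group⟩

theorem PermutesBlocks.increasingOnBlocks_insert (h : PermutesBlocks K L π x)
    (hv : IsCut L l v) (hlt : π l < π (l + 1)) : IncreasingOnBlocks (insert v L) x := by
  intro r hr
  rcases Finset.mem_insert.1 hr with rfl | hr
  · refine lt_of_blockIndex_lt (J := K) ?_
    rwa [h.blockIndex_apply, h.blockIndex_apply, hv.2, hv.blockIndex_succ]
  · exact h.increasing r hr

theorem PermutesBlocks.isCoreOf (h : PermutesBlocks K L π x) (hu : IsCut K k u)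
    (hv : IsCut L l v) (hlt : π l < π (l + 1)) (hlt' : π⁻¹ k < π⁻¹ (k + 1))
    (hne : ¬(π l = k ∧ π (l + 1) = k + 1)) :
    IsCoreOf (insert u K) (insert v L) (coset (insert u K) (insert v L) x) K L (coset K L x) := by
  refine ⟨⟨x, rfl⟩, ⟨x, rfl⟩, x, ?_, h.isMinElt, (h.leftRed_insert hu hv hlt hne).symm, ?_⟩
  · exact isMinElt_of_increasingOnBlocks (h.increasingOnBlocks_insert hv hlt)
      (h.inv.increasingOnBlocks_insert hu hlt')
  · rw [rightRed_eq_leftRed_inv]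
    refine (h.inv.leftRed_insert hv hu hlt' ?_).symm
    rwa [Equiv.Perm.inv_eq_iff_eq, Equiv.Perm.inv_eq_iff_eq, eq_comm, @eq_comm _ (k + 1)]

/-! ### Switchbacks -/

theorem coset_eq_of_mem {y : Equiv.Perm (Fin (n + 1))} (h : y ∈ coset I J x) :
    coset I J y = coset I J x :=
  DoubleCoset.doubleCoset_eq_of_mem h

theorem simple_ne_of_leftRed_ne (hd : d ∈ Q)
    (hmem : longest Q ∈ coset (Q.erase c) (Q.erase d) x)
    (hinc : IncreasingOnBlocks (Q.erase d) x)
    (hred : leftRed (Q.erase c) (Q.erase d) x ≠ Q.erase c) :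
    simple d ≠ longest Q * simple c * longest Q := by
  intro heq
  have hconj : simple c = longest Q * simple d * longest Q := by
    rw [heq, ← mul_assoc, ← mul_assoc, longest_mul_self, one_mul, mul_assoc, longest_mul_self,
      mul_one]
  have h := IsAtomVia.of_simple_eq_conj ⟨Finset.notMem_erase d Q, rfl⟩
    (by rwa [Finset.insert_erase hd])
  rw [Finset.insert_erase hd] at h
  have hx : x ∈ coset (Q.erase c) (Q.erase d) (longest Q * longest (Q.erase d)) := by
    rw [coset_mul_longest, coset_eq_of_mem hmem]
    exact DoubleCoset.mem_doubleCoset_self _ _ _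
  obtain rfl := h.permutesBlocks.eq_of_mem_coset hx hinc
  exact hred h.permutesBlocks.leftRed_eq

theorem IsAtomWord.switchback (h : IsAtomWord L w (K :: T)) (hw : IsReducedWord (k :: w))
    (hc : c ∈ Q) (hd : d ∈ Q) (hcu : Q.erase c = insert u K) (hdv : Q.erase d = insert v L)
    (hu : IsCut K k u) (hv : IsCut L l v) (hlt : wordPerm w l < wordPerm w (l + 1))
    (hne : ¬(wordPerm w l = k ∧ wordPerm w (l + 1) = k + 1))
    (hprod : exprProd ([Q.erase c] ++ (K :: T) ++ [Q.erase d]) = longest Q)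
    (hlen : exprLength ([Q.erase c] ++ (K :: T) ++ [Q.erase d]) = length (longest Q)) :
    Switchback [Q.erase c, Q, Q.erase d] ([Q.erase c] ++ (K :: T) ++ [Q.erase d]) := by
  have hK : K ⊆ Q.erase c := hcu ▸ Finset.subset_insert u K
  have hL : L ⊆ Q.erase d := hdv ▸ Finset.subset_insert v L
  have hx := h.permutesBlocks
  have hcore := hx.isCoreOf hu hv hlt hw.1 hne
  have hinc := hx.increasingOnBlocks_insert hv hlt
  have hred := hx.leftRed_insert hu hv hlt hne
  rw [← hcu, ← hdv] at hcore hred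
  rw [← hdv] at hinc
  have hQ : longest Q ∈ coset (Q.erase c) (Q.erase d) (exprProd (K :: T) * longest L) := by
    rw [← hprod, exprProd_append_singleton (by simpa using h.isExpression.2.1),
      Finset.union_eq_right.2 hL, longest_inv, List.singleton_append,
      exprProd_cons_of_superset hK]
    exact DoubleCoset.mem_doubleCoset.2 ⟨_, mul_mem (longest_mem_parabolic _)
      (parabolic_mono hK (longest_mem_parabolic K)), _, longest_mem_parabolic _, by group⟩
  have hKne : K ≠ Q.erase c := fun heq => hu.1 (heq ▸ hcu ▸ Finset.mem_insert_self u K)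
  have hexpr : IsExpression (Q.erase c) (Q.erase d) ([Q.erase c] ++ (K :: T) ++ [Q.erase d]) := by
    refine h.isExpression.extend ?_ (hdv ▸ .insert hv.1)
    simpa only [hcu, Finset.erase_insert hu.1] using Adjacent.erase (Finset.mem_insert_self u K)
  have hcoset := coset_eq_of_mem hQ
  refine ⟨Q, c, d, _, K, L, _, K :: T, hc, hd,
    simple_ne_of_leftRed_ne hd hQ hinc (hred.trans_ne hKne), rfl,
    isReducedExpr_erase_erase hc hd, hcoset ▸ hcore,
    coset_mul_longest K L (exprProd (K :: T)) ▸ h.isAtomicReducedExpr hw.2, rfl,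
    isReducedExpr_of_exprProd_eq_longest (Finset.erase_subset c Q) (Finset.erase_subset d Q)
      hexpr hprod hlen⟩

/-- The expressions `[I + a + c - d - e]` that ascend from `I` to `Q` and then descend to `J`. -/
structure Peak (I Q J : Finset (Fin n)) (a c d e : Fin n) : Prop where
  first_notMem : a ∉ I
  second_notMem : c ∉ insert a I
  eq_insert_left : Q = insert c (insert a I)
  last_notMem : e ∉ J
  third_notMem : d ∉ insert e J
  eq_insert_right : Q = insert d (insert e J)

namespace Peak

theorem swap_up (h : Peak I Q J a c d e) : Peak I Q J c a d e where
  first_notMem hc := h.second_notMem (Finset.mem_insert_of_mem hc)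
  second_notMem ha := by
    rcases Finset.mem_insert.1 ha with rfl | ha
    exacts [h.second_notMem (Finset.mem_insert_self _ _), h.first_notMem ha]
  eq_insert_left := h.eq_insert_left.trans (Finset.insert_comm c a I)
  last_notMem := h.last_notMem
  third_notMem := h.third_notMem
  eq_insert_right := h.eq_insert_right

theorem reverse (h : Peak I Q J a c d e) : Peak J Q I e d c a :=
  ⟨h.last_notMem, h.third_notMem, h.eq_insert_right, h.first_notMem, h.second_notMem,
    h.eq_insert_left⟩

theorem swap_down (h : Peak I Q J a c d e) : Peak I Q J a c e d :=
  h.reverse.swap_up.reverse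

theorem erase_third (h : Peak I Q J a c d e) : Q.erase d = insert e J := by
  rw [h.eq_insert_right, Finset.erase_insert h.third_notMem]

theorem erase_second (h : Peak I Q J a c d e) : Q.erase c = insert a I :=
  h.reverse.erase_third

theorem third_mem (h : Peak I Q J a c d e) : d ∈ Q :=
  h.eq_insert_right ▸ Finset.mem_insert_self _ _

theorem second_mem (h : Peak I Q J a c d e) : c ∈ Q :=
  h.reverse.third_mem

theorem walk_eq (h : Peak I Q J a c d e) :
    walk I [add a, add c, sub d, sub e] = [I, insert a I, Q, insert e J, J] := by
  rw [walk, walk, ← h.eq_insert_left, walk, h.erase_third, walk, Finset.erase_insert h.last_notMem,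
    walk]

theorem isReducedExpr (h : Peak I Q J a c d e) :
    IsReducedExpr I J (coset I J (longest Q)) (walk I [add a, add c, sub d, sub e]) := by
  have hI := Finset.subset_insert a I
  have hJ := Finset.subset_insert e J
  have hM := h.erase_second ▸ Finset.erase_subset c Q
  have hN := h.erase_third ▸ Finset.erase_subset d Q
  obtain ⟨-, hexpr, -, hlen⟩ := isReducedExpr_erase_erase h.second_mem h.third_mem
  have hprod := exprProd_of_subset_of_superset hM hN
  rw [h.erase_second, h.erase_third] at hexpr hlen
  rw [hprod] at hlen
  rw [h.walk_eq]
  refine isReducedExpr_of_exprProd_eq_longest (hI.trans hM) (hJ.trans hN)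
    (hexpr.extend (.insert h.first_notMem) ?_) ?_ ?_
  · have := Adjacent.erase (Finset.mem_insert_self e J)
    rwa [Finset.erase_insert h.last_notMem] at this
  · exact (exprProd_trim (E := [Q]) hI hJ).trans hprod
  · exact (exprLength_trim (E := [Q]) hI hJ).trans hlen.symm

theorem upUp (h : Peak I Q J a c d e) :
    InContext UpUp (walk I [add a, add c, sub d, sub e]) (walk I [add c, add a, sub d, sub e]) := by
  have hne : a ≠ c := fun hac => h.second_notMem (hac ▸ Finset.mem_insert_self a I)
  rw [h.walk_eq, h.swap_up.walk_eq]
  refine ⟨[], [I, insert a I, Q], [I, insert c I, Q], [insert e J, J],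
    ⟨I, a, c, h.first_notMem, h.swap_up.first_notMem, hne, ?_, ?_⟩, rfl, rfl⟩
  · rw [walk, walk, walk, ← h.eq_insert_left]
  · rw [walk, walk, walk, ← h.swap_up.eq_insert_left]

theorem downDown (h : Peak I Q J a c d e) :
    InContext DownDown (walk I [add a, add c, sub d, sub e])
      (walk I [add a, add c, sub e, sub d]) := by
  have hne : d ≠ e := fun hde => h.third_notMem (hde ▸ Finset.mem_insert_self d J)
  rw [h.walk_eq, h.swap_down.walk_eq]
  refine ⟨[I, insert a I], [Q, insert e J, J], [Q, insert d J, J], [],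
    ⟨Q, d, e, h.third_mem, h.swap_down.third_mem, hne, ?_, ?_⟩, rfl, rfl⟩
  · rw [walk, walk, walk, h.erase_third, Finset.erase_insert h.last_notMem]
  · rw [walk, walk, walk, h.swap_down.erase_third, Finset.erase_insert h.swap_down.last_notMem]

theorem switchback (h : Peak I Q J a c d e) (hE : IsAtomWord L w (K :: T))
    (hw : IsReducedWord (k :: w)) (hk : IsAtomVia k I (insert u K) K u a)
    (hl : IsAtomVia l L (insert e J) J e v) (hlt : wordPerm w l < wordPerm w (l + 1))
    (hne : ¬(wordPerm w l = k ∧ wordPerm w (l + 1) = k + 1))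
    (hprod : exprProd (I :: insert u K :: (K :: T) ++ [insert e J, J]) = longest Q)
    (hlen : exprLength (I :: insert u K :: (K :: T) ++ [insert e J, J]) = length (longest Q)) :
    InContext Switchback (walk I [add a, add c, sub d, sub e])
      (I :: insert u K :: (K :: T) ++ [insert e J, J]) := by
  have hM := h.erase_second.trans hk.insert_left
  have hN := h.erase_third
  rw [exprProd_trim hk.left_subset hl.right_subset] at hprod
  rw [exprLength_trim hk.left_subset hl.right_subset] at hlen
  have hswitch := hE.switchback hw h.second_mem h.third_mem hM (hN.trans hl.insert_left.symm)
    hk.isCut hl.isCut_left hlt hne (by rwa [hM, hN]) (by rwa [hM, hN])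
  rw [hM, hN] at hswitch
  refine ⟨[I], _, _, [J], hswitch, ?_, by simp⟩
  rw [h.walk_eq, hk.insert_left]
  rfl

end Peak

/-! ### Atomic braid relations as double coset braid relations -/

theorem IsCut.ne {i j : ℕ} (hu : IsCut J i u) (hv : IsCut J j v) (hij : i ≠ j) : u ≠ v := by
  rintro rfl
  exact hij (hu.2.symm.trans hv.2)

theorem isReducedWord_braid (near : l = k + 1 ∨ k = l + 1) : IsReducedWord [k, l, k] := by
  simp only [IsReducedWord, wordPerm_cons_inv_apply]
  rcases near with rfl | rfl <;> simp [wordPerm, swap_succ_apply_self, swap_apply_succ_succ]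

theorem isReducedWord_comm (far : k + 1 < l ∨ l + 1 < k) : IsReducedWord [k, l] := by
  obtain ⟨hk, hk'⟩ := swap_apply_of_far far.symm
  simp [IsReducedWord, wordPerm, hk, hk']

theorem wordPerm_braid_lt (near : l = k + 1 ∨ k = l + 1) :
    wordPerm [k, l, k] (k + 1) < wordPerm [k, l, k] k ∧
      wordPerm [k, l, k] (l + 1) < wordPerm [k, l, k] l := by
  rcases near with rfl | rfl <;> simp [wordPerm, swap_succ_apply_self, swap_apply_succ_succ]

theorem wordPerm_comm_lt (far : k + 1 < l ∨ l + 1 < k) :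
    wordPerm [k, l] (k + 1) < wordPerm [k, l] k ∧ wordPerm [k, l] (l + 1) < wordPerm [k, l] l := by
  obtain ⟨hl, hl'⟩ := swap_apply_of_far far
  obtain ⟨hk, hk'⟩ := swap_apply_of_far far.symm
  simp [wordPerm, hk, hk', hl, hl']

namespace BraidPath

variable {b : Fin n}

theorem peak (h : BraidPath k l I K L J a b c d e) :
    Peak I (insert d (insert e J)) J a c d e := by
  have near := h.near
  have hcb : c ≠ b := h.middle.isCut_left.ne h.left.isCut (by omega)
  have hde : d ≠ e := h.cut.ne h.right.isCut (by omega)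
  refine ⟨h.left.notMem_left, ?_, ?_, h.right.isCut.1, ?_, rfl⟩
  · rw [h.left.insert_left, Finset.mem_insert, not_or]
    exact ⟨hcb, h.middle.notMem_left⟩
  · rw [← h.right.insert_left, Finset.insert_comm, ← h.middle.insert_left, Finset.insert_comm,
      ← h.left.insert_left]
  · rw [Finset.mem_insert, not_or]
    exact ⟨hde, h.cut.1⟩

theorem exprProd_eq_longest (h : BraidPath k l I K L J a b c d e) :
    exprProd (walk I [add a, sub b, add c, sub d, add b, sub e]) =
      longest (insert d (insert e J)) := by
  have hword := h.isAtomWord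
  rw [h.walk_eq] at hword ⊢
  have hM := h.left.insert_left ▸ h.peak.erase_second ▸ Finset.erase_subset c _
  have hN := h.peak.erase_third ▸ Finset.erase_subset d _
  have hL := h.right.left_subset.trans hN
  refine hword.exprProd_eq_longest (exprProd_mem_parabolic ?_) fun r hr hrJ => ?_
  · simp only [List.forall_mem_cons]
    exact ⟨h.left.left_subset.trans hM, hM, h.left.right_subset.trans hM,
      Finset.insert_subset h.peak.third_mem hL, hL, hN, h.right.right_subset.trans hN, by simp⟩
  · obtain ⟨hk, hl⟩ := wordPerm_braid_lt h.near
    simp only [Finset.mem_insert, hrJ, or_false] at hr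
    rcases hr with rfl | rfl
    · rwa [h.cut.blockIndex_succ, h.cut.2]
    · rwa [h.right.isCut.blockIndex_succ, h.right.isCut.2]

theorem isCore (h : BraidPath k l I K L J a b c d e) :
    IsCore I J (coset I J (longest (insert d (insert e J)))) :=
  h.exprProd_eq_longest ▸ h.isAtomWord.isCore

theorem isAtomicReducedExpr (h : BraidPath k l I K L J a b c d e) :
    IsAtomicReducedExpr I J (coset I J (longest (insert d (insert e J))))
      (walk I [add a, sub b, add c, sub d, add b, sub e]) :=
  h.exprProd_eq_longest ▸ h.isAtomWord.isAtomicReducedExpr (isReducedWord_braid h.near)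

theorem switchback (h : BraidPath k l I K L J a b c d e) :
    InContext Switchback (walk I [add a, add c, sub d, sub e])
      (walk I [add a, sub b, add c, sub d, add b, sub e]) := by
  have near := h.near
  have hprod := h.exprProd_eq_longest
  have hlen := h.isAtomWord.length_exprProd_eq (isReducedWord_braid near)
  rw [hprod, h.walk_eq] at hlen
  rw [h.walk_eq] at hprod ⊢
  have hmid : IsAtomWord L [l] [K, insert d L, L] := .cons _ _ _ _ _ _ h.middle.isAtom .nil
  refine h.peak.switchback hmid (isReducedWord_braid near.symm).2 h.left h.right ?_ ?_ hprod
    hlen.symm <;>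
    rcases near with rfl | rfl <;> simp [wordPerm, swap_succ_apply_self, swap_apply_succ_succ]

end BraidPath

namespace CommPath

variable {b : Fin n}

theorem peak (h : CommPath k l I K J a b c d) : Peak I (insert b (insert d J)) J a c b d := by
  have far := h.far
  have hcb : c ≠ b := h.right.isCut_left.ne h.left.isCut (by omega)
  have hbd : b ≠ d := h.cut.ne h.right.isCut (by omega)
  refine ⟨h.left.notMem_left, ?_, ?_, h.right.isCut.1, ?_, rfl⟩
  · rw [h.left.insert_left, Finset.mem_insert, not_or]
    exact ⟨hcb, h.right.notMem_left⟩
  · rw [← h.right.insert_left, Finset.insert_comm, ← h.left.insert_left]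
  · rw [Finset.mem_insert, not_or]
    exact ⟨hbd, h.cut.1⟩

theorem exprProd_eq_longest (h : CommPath k l I K J a b c d) :
    exprProd (walk I [add a, sub b, add c, sub d]) = longest (insert b (insert d J)) := by
  have hword := h.isAtomWord
  rw [h.walk_eq] at hword ⊢
  have hM := h.left.insert_left ▸ h.peak.erase_second ▸ Finset.erase_subset c _
  have hN := h.peak.erase_third ▸ Finset.erase_subset b _
  refine hword.exprProd_eq_longest (exprProd_mem_parabolic ?_) fun r hr hrJ => ?_
  · simp only [List.forall_mem_cons]
    exact ⟨h.left.left_subset.trans hM, hM, h.left.right_subset.trans hM, hN,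
      h.right.right_subset.trans hN, by simp⟩
  · obtain ⟨hk, hl⟩ := wordPerm_comm_lt h.far
    simp only [Finset.mem_insert, hrJ, or_false] at hr
    rcases hr with rfl | rfl
    · rwa [h.cut.blockIndex_succ, h.cut.2]
    · rwa [h.right.isCut.blockIndex_succ, h.right.isCut.2]

theorem isCore (h : CommPath k l I K J a b c d) :
    IsCore I J (coset I J (longest (insert b (insert d J)))) :=
  h.exprProd_eq_longest ▸ h.isAtomWord.isCore

theorem isAtomicReducedExpr (h : CommPath k l I K J a b c d) :
    IsAtomicReducedExpr I J (coset I J (longest (insert b (insert d J))))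
      (walk I [add a, sub b, add c, sub d]) :=
  h.exprProd_eq_longest ▸ h.isAtomWord.isAtomicReducedExpr (isReducedWord_comm h.far)

theorem switchback (h : CommPath k l I K J a b c d) :
    InContext Switchback (walk I [add a, add c, sub b, sub d])
      (walk I [add a, sub b, add c, sub d]) := by
  have far := h.far
  have hprod := h.exprProd_eq_longest
  have hlen := h.isAtomWord.length_exprProd_eq (isReducedWord_comm far)
  rw [hprod, h.walk_eq] at hlen
  rw [h.walk_eq] at hprod ⊢
  refine h.peak.switchback .nil ⟨?_, trivial⟩ h.left h.right ?_ ?_ hprod hlen.symm <;>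
    simp only [wordPerm, inv_one, Equiv.Perm.one_apply] <;> omega

end CommPath

end Switchbacks

end AtomicCoset

theorem mainTheorem5 (n : ℕ) :
    (∀ (I J : Finset (Fin n)) (p : Set (Equiv.Perm (Fin (n + 1)))), IsCore I J p →
      ∀ E F : List (Finset (Fin n)), IsAtomicReducedExpr I J p E → IsAtomicReducedExpr I J p F →
        Relation.ReflTransGen (AtomicMove I J p) E F) ∧
    (∀ (J : Finset (Fin n)) (i : ℕ), 1 ≤ i → i + 1 ≤ Jᶜ.card →
      ∃ (I : Finset (Fin n)) (p : Set (Equiv.Perm (Fin (n + 1)))) (a b c d e f : Fin n),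
        IsCore I J p ∧
        IsAtomWord J [i, i + 1, i] (walk I [add a, sub b, add c, sub d, add b, sub e]) ∧
        IsAtomWord J [i + 1, i, i + 1] (walk I [add c, sub f, add a, sub e, add f, sub d]) ∧
        IsAtomicReducedExpr I J p (walk I [add a, sub b, add c, sub d, add b, sub e]) ∧
        IsReducedExpr I J p (walk I [add a, add c, sub d, sub e]) ∧
        IsReducedExpr I J p (walk I [add c, add a, sub d, sub e]) ∧
        IsReducedExpr I J p (walk I [add c, add a, sub e, sub d]) ∧
        IsAtomicReducedExpr I J p (walk I [add c, sub f, add a, sub e, add f, sub d]) ∧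
        InContext Switchback (walk I [add a, add c, sub d, sub e])
          (walk I [add a, sub b, add c, sub d, add b, sub e]) ∧
        InContext UpUp (walk I [add a, add c, sub d, sub e])
          (walk I [add c, add a, sub d, sub e]) ∧
        InContext DownDown (walk I [add c, add a, sub d, sub e])
          (walk I [add c, add a, sub e, sub d]) ∧
        InContext Switchback (walk I [add c, add a, sub e, sub d])
          (walk I [add c, sub f, add a, sub e, add f, sub d])) ∧
    (∀ (J : Finset (Fin n)) (i j : ℕ), 1 ≤ i → i ≤ Jᶜ.card → 1 ≤ j → j ≤ Jᶜ.card →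
      (i + 1 < j ∨ j + 1 < i) →
      ∃ (I : Finset (Fin n)) (p : Set (Equiv.Perm (Fin (n + 1)))) (a b c d : Fin n),
        IsCore I J p ∧
        IsAtomWord J [i, j] (walk I [add a, sub b, add c, sub d]) ∧
        IsAtomWord J [j, i] (walk I [add c, sub d, add a, sub b]) ∧
        IsAtomicReducedExpr I J p (walk I [add a, sub b, add c, sub d]) ∧
        IsReducedExpr I J p (walk I [add a, add c, sub b, sub d]) ∧
        IsReducedExpr I J p (walk I [add c, add a, sub b, sub d]) ∧
        IsReducedExpr I J p (walk I [add c, add a, sub d, sub b]) ∧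
        IsAtomicReducedExpr I J p (walk I [add c, sub d, add a, sub b]) ∧
        InContext Switchback (walk I [add a, add c, sub b, sub d])
          (walk I [add a, sub b, add c, sub d]) ∧
        InContext UpUp (walk I [add a, add c, sub b, sub d])
          (walk I [add c, add a, sub b, sub d]) ∧
        InContext DownDown (walk I [add c, add a, sub b, sub d])
          (walk I [add c, add a, sub d, sub b]) ∧
        InContext Switchback (walk I [add c, add a, sub d, sub b])
          (walk I [add c, sub d, add a, sub b])) := by
  refine ⟨fun _ _ _ _ _ _ hE hF => reflTransGen_atomicMove hE hF, fun J i hi hi' => ?_,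
    fun J i j hi hi' hj hj' far => ?_⟩
  · obtain ⟨e, he⟩ := exists_isCut hi (Nat.le_of_succ_le hi')
    obtain ⟨d, hd⟩ := exists_isCut (Nat.le_add_left 1 i) hi'
    obtain ⟨I, K, L, K', L', a, b, c, f, h, h'⟩ := exists_braidPaths (Or.inl rfl) he hd
    have hatomic' := h'.isAtomicReducedExpr
    rw [Finset.insert_comm e d J] at hatomic'
    exact ⟨I, _, a, b, c, d, e, f, h.isCore, h.isAtomWord, h'.isAtomWord, h.isAtomicReducedExpr,
      h.peak.isReducedExpr, h.peak.swap_up.isReducedExpr, h.peak.swap_up.swap_down.isReducedExpr,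
      hatomic', h.switchback, h.peak.upUp, h.peak.swap_up.downDown, h'.switchback⟩
  · obtain ⟨b, hb⟩ := exists_isCut hi hi'
    obtain ⟨d, hd⟩ := exists_isCut hj hj'
    obtain ⟨I, K, K', a, c, h, h'⟩ := exists_commPaths far hb hd
    have hatomic' := h'.isAtomicReducedExpr
    rw [Finset.insert_comm d b J] at hatomic'
    exact ⟨I, _, a, b, c, d, h.isCore, h.isAtomWord, h'.isAtomWord, h.isAtomicReducedExpr,
      h.peak.isReducedExpr, h.peak.swap_up.isReducedExpr, h.peak.swap_up.swap_down.isReducedExpr,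
      hatomic', h.switchback, h.peak.upUp, h.peak.swap_up.downDown, h'.switchback⟩
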